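/- A \emph{vertex ring} is an abelian group $V$ with biadditive products $(u,v)\mapsto u_nv$ ($n\in\mathbb Z$) and a vacuum vector $\mathbf 1$ satisfying regularity ($u_nv=0$ for $n\gg 0$), creation ($v_n\mathbf 1=0$ for $n\ge 0$, $v_{-1}\mathbf 1=v$) and the Jacobi identity. It is \emph{commutative} if it equals its centre, i.e. if all operators $u_m$, $v_n$ commute; it is then a commutative ring with product $rs=r_{-1}s$ and unit $\mathbf 1$, and $D_j(r)=r_{-j-1}\mathbf 1$ is its canonical Hasse--Schmidt derivation. For a commutative vertex ring $R$, an \emph{$R$-vertex algebra} is a vertex ring $V$ with a vertex ring homomorphism $\iota\colon R\to V$ into the centre of $V$; it is an $R$-module via $rv=\iota(r)_{-1}v$. A (commutative) \emph{extension} $S/R$ is an $R$-vertex algebra $S$ that is commutative as a vertex ring. For such $S$ and an $R$-vertex algebra $V$, the tensor product $V\otimes_RS$ is an $S$-vertex algebra under $(u\otimes s)_n(v\otimes t)=\sum_{j\ge0}u_{n+j}v\otimes D_j(s)t$, with vacuum $\mathbf 1\otimes 1$ and structure map $s\mapsto \mathbf 1\otimes s$. An \emph{$S/R$-form} of $V$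 is an $R$-vertex algebra $W$ such that $W\otimes_RS\cong V\otimes_RS$ as $S$-vertex algebras. $\mathbf{Aut}(V)$ is the group functor $A\mapsto \mathrm{Aut}_{A}(V\otimes_RA)$ (automorphisms of $A$-vertex algebras) on commutative $R$-vertex algebras. For a group functor $\mathbf G$ on commutative $R$-vertex algebras, let $d^0(a)=1\otimes a$, $d^1(a)=a\otimes1$ be the maps $S\to S\otimes_RS$, and let $d^0(a\otimes b)=1\otimes a\otimes b$, $d^1(a\otimes b)=a\otimes 1\otimes b$, $d^2(a\otimes b)=a\otimes b\otimes 1$ be the maps $S\otimes_RS\to S\otimes_RS\otimes_RS$; the maps induced on $\mathbf G$ are denoted in the same way. Let $Z^1(S/R,\mathbf G)$ be the set of $\varphi\in\mathbf G(S\otimes_RS)$ with $d^1\varphi=(d^0\varphi)(d^2\varphi)$, and let $H^1(S/R,\mathbf G)$ be its quotient by the equivalence relation $\varphi\sim(d^0g)\,\varphi\,(d^1g)^{-1}$, $g\in\mathbf G(S)$, with distinguished element $1$ the class of the trivial cocycle. \textbf{Theorem.} Let $S/R$ be an extension of commutative vertex rings such that $S$ is faithfully flat as an $R$-module, and let $V$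 be an $R$-vertex algebra. Then there is a bijection from the set of $R$-isomorphism classes of $S/R$-forms of $V$ to $H^1(S/R,\mathbf{Aut}(V))$, which sends the class of $V$ to the distinguished element $1$. It is the usual one: for every $S/R$-form $W$ and every isomorphism $\theta\colon W\otimes_RS\to V\otimes_RS$ of $S$-vertex algebras, the class of $W$ is sent to the class of the cocycle $(d^0\theta)(d^1\theta)^{-1}$, where $d^i\theta$ is the base change of $\theta$ along $d^i\colon S\to S\otimes_RS$. -/

import Mathlib

open scoped TensorProduct

/-- A vertex ring: an abelian group `V` with biadditive products `uₙ v` (`n ∈ ℤ`), written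
`nprod n u v`, so that `Y(u, z) = ∑ₙ uₙ z⁻ⁿ⁻¹`, and a vacuum vector `vac`, satisfying regularity,
creation (`vₙ 𝟏 = 0` for `n ≥ 0` and `v₋₁ 𝟏 = v`) and the Jacobi identity. The Jacobi identity is
written in components, that is, as the equality of all coefficients of the formal identity
`z₀⁻¹ δ((z₁ - z₂) / z₀) Y(u, z₁) Y(v, z₂) w - z₀⁻¹ δ((z₂ - z₁) / (-z₀)) Y(v, z₂) Y(u, z₁) w =
z₂⁻¹ δ((z₁ - z₀) / z₂) Y(Y(u, z₀) v, z₂) w`. All its sums are finite by regularity. -/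
class VertexRing (V : Type*) [AddCommGroup V] where
  nprod : ℤ → V →+ V →+ V
  vac : V
  regularity : ∀ u v : V, ∃ N : ℤ, ∀ n : ℤ, N ≤ n → nprod n u v = 0
  creation_of_nonneg : ∀ (v : V) (n : ℤ), 0 ≤ n → nprod n v vac = 0
  creation_neg_one : ∀ v : V, nprod (-1) v vac = v
  jacobi : ∀ (u v w : V) (l m n : ℤ),
    ∑ᶠ i : ℕ, Ring.choose m i • nprod (m + n - i) (nprod (l + i) u v) w =
      ∑ᶠ i : ℕ, ((-1) ^ i * Ring.choose l i) •
        (nprod (m + l - i) u (nprod (n + i) v w) -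
          (l.negOnePow : ℤ) • nprod (n + l - i) v (nprod (m + i) u w))

namespace VertexRing

theorem finsum_nat_eq_sum_range {M : Type*} [AddCommMonoid M] {f : ℕ → M} (N : ℕ)
    (h : ∀ i, N ≤ i → f i = 0) : ∑ᶠ i, f i = ∑ i ∈ Finset.range N, f i := by
  apply finsum_eq_sum_of_support_subset
  intro i hi
  simp only [Finset.coe_range, Set.mem_Iio]
  by_contra hc
  exact hi (h i (not_lt.mp hc))

theorem sum_range_antidiagonal {M : Type*} [AddCommMonoid M] (f : ℕ → ℕ → M) (N A B : ℕ)
    (hA : N ≤ A) (hB : N ≤ B) (h : ∀ p q, N ≤ p + q → f p q = 0) :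
    ∑ k ∈ Finset.range N, ∑ x ∈ Finset.HasAntidiagonal.antidiagonal k, f x.1 x.2 =
      ∑ p ∈ Finset.range A, ∑ q ∈ Finset.range B, f p q := by
  rw [← Finset.sum_product', Finset.sum_sigma']
  refine Finset.sum_of_injOn (fun x => x.2) ?_ ?_ ?_ ?_
  · rintro ⟨k, p, q⟩ h1 ⟨k', p', q'⟩ h2 h3
    simp at h1 h2 h3
    obtain ⟨rfl, rfl⟩ := h3
    obtain ⟨_, rfl⟩ := h1
    obtain ⟨_, rfl⟩ := h2
    rfl
  · rintro ⟨k, p, q⟩ h1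
    simp at h1 ⊢
    omega
  · rintro ⟨p, q⟩ _ h2
    apply h
    by_contra hc
    apply h2
    exact ⟨⟨p + q, p, q⟩, by simpa using hc, rfl⟩
  · intros; rfl

variable {V : Type*} [AddCommGroup V] [VertexRing V]

theorem exists_nat_bound (u v : V) (n : ℤ) : ∃ N : ℕ, ∀ j : ℕ, N ≤ j → nprod (n + j) u v = 0 := by
  obtain ⟨N, hN⟩ := regularity u v
  exact ⟨(N - n).toNat, fun j hj => hN _ (by omega)⟩

theorem negOnePow_mul_choose_neg (m k : ℕ) :
    ((-1) ^ k * Ring.choose (-(m : ℤ) - 1) k : ℤ) = ((m + k).choose k : ℕ) := by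
  have : -(m:ℤ) - 1 = -((m + 1 : ℕ) : ℤ) := by push_cast; ring
  rw [this, Ring.choose_neg, Units.smul_def, zsmul_eq_mul]
  have h2 : ((m + 1 : ℕ) : ℤ) + k - 1 = ((m + k : ℕ) : ℤ) := by push_cast; ring
  rw [h2, Ring.choose_natCast]
  simp [← mul_assoc, ← mul_pow, Int.negOnePow_def]

theorem comm_formula (u v w : V) (m n : ℤ) :
    ∑ᶠ i : ℕ, Ring.choose m i • nprod (m + n - i) (nprod (i : ℤ) u v) w =
      nprod m u (nprod n v w) - nprod n v (nprod m u w) := by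
  have h := jacobi u v w 0 m n
  simp only [zero_add] at h
  rw [h, finsum_nat_eq_sum_range 1]
  · simp
  · intro i hi
    obtain ⟨k, rfl⟩ : ∃ k, i = k + 1 := ⟨i - 1, by omega⟩
    simp [Ring.choose_zero_succ]

theorem assoc_formula (u v w : V) (l n : ℤ) :
    nprod n (nprod l u v) w =
      ∑ᶠ i : ℕ, ((-1) ^ i * Ring.choose l i) •
        (nprod (l - i) u (nprod (n + i) v w) -
          (l.negOnePow : ℤ) • nprod (n + l - i) v (nprod (i : ℤ) u w)) := by
  have h := jacobi u v w l 0 n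
  simp only [zero_add] at h
  rw [← h, finsum_nat_eq_sum_range 1]
  · simp
  · intro i hi
    obtain ⟨k, rfl⟩ : ∃ k, i = k + 1 := ⟨i - 1, by omega⟩
    simp [Ring.choose_zero_succ]

theorem vac_comm (u w : V) (m n : ℤ) :
    nprod m u (nprod n vac w) = nprod n vac (nprod m u w) := by
  have h := comm_formula u vac w m n
  rw [finsum_nat_eq_sum_range 0] at h
  · rw [Finset.range_zero, Finset.sum_empty] at h; exact sub_eq_zero.mp h.symm
  · intro i _
    rw [creation_of_nonneg _ _ (by omega)]; simp

theorem vac_nprod_nonneg (v : V) (n : ℤ) (hn : 0 ≤ n) : nprod n vac v = 0 := by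
  conv_lhs => rw [← creation_neg_one v]
  rw [← vac_comm, creation_of_nonneg _ _ hn, map_zero]

theorem vac_nprod_neg_one (v : V) : nprod (-1) vac v = v := by
  conv_lhs => rw [← creation_neg_one v]
  rw [← vac_comm, creation_neg_one, creation_neg_one]

theorem vac_nprod_vac (k : ℕ) (hk : 1 ≤ k) : nprod (-(k : ℤ) - 1) (vac : V) vac = 0 := by
  induction k using Nat.strong_induction_on with
  | _ k ih =>
    have h := assoc_formula (vac : V) vac vac (-1) (-(k : ℤ) - 1)
    rw [creation_neg_one, finsum_nat_eq_sum_range (k + 1)] at h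
    · have hc : ∀ i : ℕ, ((-1) ^ i * Ring.choose (-1) i : ℤ) = 1 := fun i => by
        simpa using negOnePow_mul_choose_neg 0 i
      simp only [hc, one_smul, creation_of_nonneg _ _ (Int.natCast_nonneg _), map_zero, smul_zero,
        sub_zero] at h
      obtain ⟨j, rfl⟩ : ∃ j, k = j + 1 := ⟨k - 1, by omega⟩
      rw [Finset.sum_range_succ, Finset.sum_range_succ', Finset.sum_eq_zero] at h
      · simp only [zero_add, Nat.cast_zero, sub_zero, add_zero, vac_nprod_neg_one] at h
        have e1 : (-((j + 1 : ℕ) : ℤ) - 1 + ((j + 1 : ℕ) : ℤ)) = -1 := by ring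
        have e2 : (-1 - ((j + 1 : ℕ) : ℤ)) = -((j + 1 : ℕ) : ℤ) - 1 := by ring
        rw [e1, creation_neg_one, e2] at h
        simpa using h
      · intro i hi
        have hi' := Finset.mem_range.mp hi
        have := ih (j - i) (by omega) (by omega)
        have e : (-((j + 1 : ℕ) : ℤ) - 1 + ((i + 1 : ℕ) : ℤ)) = -((j - i : ℕ) : ℤ) - 1 := by
          push_cast [Nat.cast_sub hi'.le]; ring
        rw [e, this, map_zero]
    · intro i hi
      rw [creation_of_nonneg _ _ (by omega), creation_of_nonneg _ _ (by omega)]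
      simp

theorem vac_nprod_of_ne (v : V) (n : ℤ) (hn : n ≠ -1) : nprod n vac v = 0 := by
  rcases le_or_gt 0 n with h | h
  · exact vac_nprod_nonneg v n h
  · conv_lhs => rw [← creation_neg_one v]
    rw [← vac_comm]
    obtain ⟨k, rfl⟩ : ∃ k : ℕ, n = -(k : ℤ) - 1 := ⟨(-n - 1).toNat, by omega⟩
    rw [vac_nprod_vac k (by omega), map_zero]

variable (V) in
/-- The centre: those `v` with `Y(v, z₁) Y(u, z₂) = Y(u, z₂) Y(v, z₁)` for all `u`. -/
def center : Set V := {v | ∀ (u w : V) (m n : ℤ), nprod m v (nprod n u w) = nprod n u (nprod m v w)}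

theorem nprod_of_mem_center {v : V} (hv : v ∈ center V) (u : V) (n : ℤ) (hn : 0 ≤ n) :
    nprod n v u = 0 := by
  conv_lhs => rw [← creation_neg_one u]
  rw [hv, creation_of_nonneg _ _ hn, map_zero]

theorem nprod_of_mem_center' {v : V} (hv : v ∈ center V) (u : V) (n : ℤ) (hn : 0 ≤ n) :
    nprod n u v = 0 := by
  conv_lhs => rw [← creation_neg_one v]
  rw [← hv, creation_of_nonneg _ _ hn, map_zero]

theorem mem_center_iff (v : V) :
    v ∈ center V ↔ ∀ (u : V) (n : ℤ), 0 ≤ n → nprod n v u = 0 ∧ nprod n u v = 0 := by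
  refine ⟨fun h u n hn => ⟨nprod_of_mem_center h u n hn, nprod_of_mem_center' h u n hn⟩, ?_⟩
  intro h u w m n
  have h2 := comm_formula v u w m n
  rw [finsum_nat_eq_sum_range 0] at h2
  · rw [Finset.range_zero, Finset.sum_empty] at h2; exact sub_eq_zero.mp h2.symm
  · intro i _
    rw [(h u i (by omega)).1]; simp

/-- The canonical Hasse-Schmidt derivation `Dₘ(v) = v₋ₘ₋₁ 𝟏`. -/
def hasse (m : ℕ) : V →+ V := (nprod (-(m : ℤ) - 1)).flip vac

theorem hasse_apply (m : ℕ) (v : V) : hasse m v = nprod (-(m : ℤ) - 1) v vac := rfl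

@[simp] theorem hasse_zero (v : V) : hasse 0 v = v := by
  simp [hasse_apply, creation_neg_one]

theorem hasse_vac (m : ℕ) (hm : 1 ≤ m) : hasse m (vac : V) = 0 := vac_nprod_vac m hm

theorem hasse_hasse (k m : ℕ) (v : V) :
    hasse k (hasse m v) = (k + m).choose k • hasse (k + m) v := by
  rw [hasse_apply, hasse_apply, assoc_formula, finsum_nat_eq_sum_range (k + 1)]
  · rw [Finset.sum_range_succ, Finset.sum_eq_zero]
    · rw [creation_of_nonneg v _ (Int.natCast_nonneg _)]
      have : (-(k : ℤ) - 1 + k) = -1 := by ring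
      rw [this, creation_neg_one, negOnePow_mul_choose_neg, hasse_apply]
      have : -(m : ℤ) - 1 - k = -((k + m : ℕ) : ℤ) - 1 := by push_cast; ring
      rw [this]; simp [add_comm]
    · intro i hi
      rw [Finset.mem_range] at hi
      rw [vac_nprod_of_ne _ _ (by omega), creation_of_nonneg v _ (by omega)]
      simp
  · intro i hi
    rw [vac_nprod_of_ne _ _ (by omega), creation_of_nonneg v _ (by omega)]
    simp

theorem nprod_neg_one_of_mem_center {v : V} (hv : v ∈ center V) (u w : V) (n : ℤ) (N : ℕ)
    (hN : ∀ j : ℕ, N ≤ j → nprod (n + j) u w = 0) :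
    nprod n (nprod (-1) v u) w =
      ∑ i ∈ Finset.range N, nprod (-(i : ℤ) - 1) v (nprod (n + i) u w) := by
  rw [assoc_formula, finsum_nat_eq_sum_range N]
  · refine Finset.sum_congr rfl fun i _ => ?_
    have hc : ((-1) ^ i * Ring.choose (-1) i : ℤ) = 1 := by
      simpa using negOnePow_mul_choose_neg 0 i
    rw [hc, nprod_of_mem_center hv _ _ (Int.natCast_nonneg i)]
    have : (-1 - (i : ℤ)) = -i - 1 := by ring
    simp [this]
  · intro i hi
    rw [nprod_of_mem_center hv _ _ (Int.natCast_nonneg i), hN i hi]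
    simp

theorem hasse_nprod_neg_one (m : ℕ) (v w : V) :
    nprod (-1) (hasse m v) w = nprod (-(m : ℤ) - 1) v w := by
  rw [hasse_apply, assoc_formula, finsum_nat_eq_sum_range 1]
  · have : nprod (-1 + (-(m : ℤ) - 1)) vac (nprod 0 v w) = 0 := vac_nprod_of_ne _ _ (by omega)
    simp [vac_nprod_neg_one, this]
  · intro i hi
    rw [vac_nprod_of_ne _ _ (by omega), vac_nprod_of_ne _ _ (by omega)]
    simp

end VertexRing

open VertexRing in
/-- A commutative vertex ring: a vertex ring that equals its centre. It is carried together with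
the commutative ring structure `r s = r₋₁ s`, `1 = 𝟏` that it determines (every commutative
vertex ring has this structure: `VertexRing.commVertexRingOfCommutative`). -/
class CommVertexRing (R : Type*) [CommRing R] extends VertexRing R where
  mem_center : ∀ r : R, r ∈ VertexRing.center R
  one_eq_vac : (1 : R) = vac
  mul_eq_nprod : ∀ r s : R, r * s = nprod (-1) r s

namespace VertexRing

variable {V : Type*} [AddCommGroup V] [VertexRing V]

theorem nprod_neg_one_comm (h : ∀ v : V, v ∈ center V) (u v : V) :
    nprod (-1) u v = nprod (-1) v u := by
  conv_lhs => rw [← creation_neg_one v]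
  rw [h u, creation_neg_one]

theorem nprod_neg_one_assoc (h : ∀ v : V, v ∈ center V) (u v w : V) :
    nprod (-1) (nprod (-1) u v) w = nprod (-1) u (nprod (-1) v w) := by
  rw [nprod_neg_one_of_mem_center (h u) v w (-1) 1]
  · simp
  · intro j hj
    exact nprod_of_mem_center (h v) w _ (by omega)

variable (V) in
/-- The ring structure of a vertex ring that equals its centre. -/
abbrev commRingOfCommutative (h : ∀ v : V, v ∈ center V) : CommRing V :=
  { (inferInstance : AddCommGroup V) with
    mul := fun u v => nprod (-1) u v
    one := vac
    left_distrib := fun u v w => map_add (nprod (-1) u) v w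
    right_distrib := fun u v w => DFunLike.congr_fun (map_add (nprod (-1)) u v) w
    zero_mul := fun u => DFunLike.congr_fun (map_zero (nprod (-1))) u
    mul_zero := fun u => map_zero (nprod (-1) u)
    mul_assoc := nprod_neg_one_assoc h
    one_mul := vac_nprod_neg_one
    mul_one := creation_neg_one
    mul_comm := nprod_neg_one_comm h }

variable (V) in
/-- A vertex ring that equals its centre is a commutative vertex ring. -/
abbrev commVertexRingOfCommutative (h : ∀ v : V, v ∈ center V) :
    letI := commRingOfCommutative V h
    CommVertexRing V :=
  letI := commRingOfCommutative V h
  { (inferInstance : VertexRing V) with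
    mem_center := h
    one_eq_vac := rfl
    mul_eq_nprod := fun _ _ => rfl }

end VertexRing

namespace CommVertexRing

open VertexRing

variable {R : Type*} [CommRing R] [CommVertexRing R]

theorem nprod_of_nonneg (r s : R) (n : ℤ) (hn : 0 ≤ n) : nprod n r s = 0 :=
  nprod_of_mem_center (mem_center r) s n hn

theorem nprod_neg (r s : R) (k : ℕ) : nprod (-(k : ℤ) - 1) r s = hasse k r * s := by
  rw [mul_eq_nprod, hasse_nprod_neg_one]

theorem hasse_one (k : ℕ) (hk : 1 ≤ k) : hasse k (1 : R) = 0 := by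
  rw [one_eq_vac, hasse_vac k hk]

theorem hasse_mul (k : ℕ) (r s : R) :
    hasse k (r * s) =
      ∑ x ∈ Finset.HasAntidiagonal.antidiagonal k, hasse x.1 r * hasse x.2 s := by
  rw [Finset.Nat.sum_antidiagonal_eq_sum_range_succ (fun i j => hasse i r * hasse j s),
    mul_eq_nprod, hasse_apply, nprod_neg_one_of_mem_center (mem_center r) s vac _ (k + 1)]
  · refine Finset.sum_congr rfl fun i hi => ?_
    rw [Finset.mem_range] at hi
    rw [nprod_neg, hasse_apply _ s]
    have : -(k : ℤ) - 1 + i = -((k - i : ℕ) : ℤ) - 1 := by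
      rw [Nat.cast_sub (by omega)]; ring
    rw [this]
  · intro j hj
    exact creation_of_nonneg _ _ (by omega)

end CommVertexRing

open VertexRing in
/-- A vertex algebra over a commutative vertex ring `R`: a vertex ring `V` with a homomorphism
`ι : R → V` of vertex rings into the centre. It is carried together with the `R`-module structure
`r • v = ι(r)₋₁ v` that it determines, and `ι` is recovered as `ι(r) = r • 𝟏`; every such `ι`
arises (`VertexAlgebra.ofStructureMap`). That `ι` maps `𝟏 = 1` to `𝟏` is `one_smul`. -/
class VertexAlgebra (R V : Type*) [CommRing R] [CommVertexRing R] [AddCommGroup V] [VertexRing V]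
    [Module R V] : Prop where
  nprod_smul_vac : ∀ (r s : R) (n : ℤ),
    (nprod n r s) • (vac : V) = nprod n (r • (vac : V)) (s • (vac : V))
  smul_vac_mem_center : ∀ r : R, r • (vac : V) ∈ center V
  smul_eq_nprod : ∀ (r : R) (v : V), r • v = nprod (-1) (r • (vac : V)) v

namespace VertexAlgebra

open VertexRing CommVertexRing

section

variable {R V : Type*} [CommRing R] [CommVertexRing R] [AddCommGroup V] [VertexRing V]

/-- The `R`-module structure of a vertex ring with a central homomorphism `ι` from `R`. -/
abbrev moduleOfStructureMap (ι : R →+ V) (h1 : ι vac = vac)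
    (hι : ∀ (r s : R) (n : ℤ), ι (nprod n r s) = nprod n (ι r) (ι s))
    (hc : ∀ r, ι r ∈ center V) : Module R V where
  smul r v := nprod (-1) (ι r) v
  one_smul v := by
    change nprod (-1) (ι 1) v = v
    rw [one_eq_vac (R := R), h1, vac_nprod_neg_one]
  mul_smul r s v := by
    change nprod (-1) (ι (r * s)) v = nprod (-1) (ι r) (nprod (-1) (ι s) v)
    rw [mul_eq_nprod, hι, nprod_neg_one_of_mem_center (hc r) (ι s) v (-1) 1]
    · simp
    · intro j hj
      exact nprod_of_mem_center (hc s) v _ (by omega)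
  smul_zero r := map_zero (nprod (-1) (ι r))
  smul_add r := map_add (nprod (-1) (ι r))
  add_smul r s v := by
    change nprod (-1) (ι (r + s)) v = nprod (-1) (ι r) v + nprod (-1) (ι s) v
    simp
  zero_smul v := by
    change nprod (-1) (ι 0) v = 0
    simp

theorem ofStructureMap (ι : R →+ V) (h1 : ι vac = vac)
    (hι : ∀ (r s : R) (n : ℤ), ι (nprod n r s) = nprod n (ι r) (ι s))
    (hc : ∀ r, ι r ∈ center V) :
    letI := moduleOfStructureMap ι h1 hι hc
    VertexAlgebra R V ∧ ∀ r : R, r • (vac : V) = ι r := by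
  let := moduleOfStructureMap ι h1 hι hc
  have h : ∀ r : R, r • (vac : V) = ι r := fun r => creation_neg_one (ι r)
  refine ⟨⟨fun r s n => ?_, fun r => ?_, fun r v => ?_⟩, h⟩
  · rw [h, h, h, hι]
  · rw [h]; exact hc r
  · rw [h]; rfl

end

variable {R V : Type*} [CommRing R] [CommVertexRing R] [AddCommGroup V] [VertexRing V]
  [Module R V] [VertexAlgebra R V]

theorem hasse_smul_vac (r : R) (j : ℕ) : hasse j (r • (vac : V)) = hasse j r • (vac : V) := by
  have h := nprod_smul_vac (V := V) r 1 (-(j : ℤ) - 1)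
  rw [one_smul, one_eq_vac (R := R)] at h
  exact h.symm

theorem nprod_smul (n : ℤ) (r : R) (u v : V) : nprod n u (r • v) = r • nprod n u v := by
  rw [smul_eq_nprod r v, smul_eq_nprod r (nprod n u v), smul_vac_mem_center]

theorem nprod_neg_smul_vac (r : R) (j : ℕ) (v : V) :
    nprod (-(j : ℤ) - 1) (r • (vac : V)) v = hasse j r • v := by
  rw [smul_eq_nprod (hasse j r), ← hasse_smul_vac, hasse_nprod_neg_one]

theorem smul_nprod (n : ℤ) (r : R) (u v : V) (N : ℕ)
    (hN : ∀ j : ℕ, N ≤ j → nprod (n + j) u v = 0) :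
    nprod n (r • u) v = ∑ j ∈ Finset.range N, hasse j r • nprod (n + j) u v := by
  rw [smul_eq_nprod r u, nprod_neg_one_of_mem_center (smul_vac_mem_center r) u v n N hN]
  exact Finset.sum_congr rfl fun i _ => nprod_neg_smul_vac r i _

end VertexAlgebra

/-- A homomorphism of `R`-vertex algebras: an `R`-linear map of vertex rings. Since `ι(r) = r • 𝟏`,
linearity amounts to compatibility with the structure maps `ι`. -/
structure VertexAlgHom (R V W : Type*) [CommRing R] [CommVertexRing R]
    [AddCommGroup V] [VertexRing V] [Module R V] [AddCommGroup W] [VertexRing W] [Module R W]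
    extends V →ₗ[R] W where
  map_vac' : toFun VertexRing.vac = VertexRing.vac
  map_nprod' : ∀ (n : ℤ) (u v : V),
    toFun (VertexRing.nprod n u v) = VertexRing.nprod n (toFun u) (toFun v)

/-- An isomorphism of `R`-vertex algebras. -/
structure VertexAlgEquiv (R V W : Type*) [CommRing R] [CommVertexRing R]
    [AddCommGroup V] [VertexRing V] [Module R V] [AddCommGroup W] [VertexRing W] [Module R W]
    extends V ≃ₗ[R] W where
  map_vac' : toFun VertexRing.vac = VertexRing.vac
  map_nprod' : ∀ (n : ℤ) (u v : V),
    toFun (VertexRing.nprod n u v) = VertexRing.nprod n (toFun u) (toFun v)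

namespace VertexAlgHom

open VertexRing

variable {R U V W : Type*} [CommRing R] [CommVertexRing R]
  [AddCommGroup U] [VertexRing U] [Module R U]
  [AddCommGroup V] [VertexRing V] [Module R V] [AddCommGroup W] [VertexRing W] [Module R W]

theorem toLinearMap_injective :
    Function.Injective (toLinearMap : VertexAlgHom R V W → V →ₗ[R] W) := by
  rintro ⟨f, _, _⟩ ⟨g, _, _⟩ h
  simpa using h

@[ext]
theorem ext {f g : VertexAlgHom R V W} (h : ∀ v, f.toLinearMap v = g.toLinearMap v) : f = g :=
  toLinearMap_injective (LinearMap.ext h)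

theorem map_vac (f : VertexAlgHom R V W) : f.toLinearMap vac = vac := f.map_vac'

theorem map_nprod (f : VertexAlgHom R V W) (n : ℤ) (u v : V) :
    f.toLinearMap (nprod n u v) = nprod n (f.toLinearMap u) (f.toLinearMap v) :=
  f.map_nprod' n u v

theorem map_hasse (f : VertexAlgHom R V W) (n : ℕ) (v : V) :
    f.toLinearMap (hasse n v) = hasse n (f.toLinearMap v) := by
  rw [hasse_apply, map_nprod, map_vac, hasse_apply]

variable (R V) in
/-- The identity. -/
def id : VertexAlgHom R V V where
  toLinearMap := LinearMap.id
  map_vac' := rfl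
  map_nprod' _ _ _ := rfl

/-- Composition. -/
def comp (g : VertexAlgHom R V W) (f : VertexAlgHom R U V) : VertexAlgHom R U W where
  toLinearMap := g.toLinearMap ∘ₗ f.toLinearMap
  map_vac' := by
    change g.toLinearMap (f.toLinearMap vac) = vac
    rw [f.map_vac, g.map_vac]
  map_nprod' n u v := by
    change g.toLinearMap (f.toLinearMap (nprod n u v)) = _
    rw [f.map_nprod, g.map_nprod]
    rfl

end VertexAlgHom

namespace VertexAlgEquiv

open VertexRing

variable {R U V W : Type*} [CommRing R] [CommVertexRing R]
  [AddCommGroup U] [VertexRing U] [Module R U]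
  [AddCommGroup V] [VertexRing V] [Module R V] [AddCommGroup W] [VertexRing W] [Module R W]

theorem toLinearEquiv_injective :
    Function.Injective (toLinearEquiv : VertexAlgEquiv R V W → V ≃ₗ[R] W) := by
  rintro ⟨f, _, _⟩ ⟨g, _, _⟩ h
  simpa using h

@[ext]
theorem ext {f g : VertexAlgEquiv R V W} (h : ∀ v, f.toLinearEquiv v = g.toLinearEquiv v) : f = g :=
  toLinearEquiv_injective (LinearEquiv.ext h)

theorem map_vac (f : VertexAlgEquiv R V W) : f.toLinearEquiv vac = vac := f.map_vac'

theorem map_nprod (f : VertexAlgEquiv R V W) (n : ℤ) (u v : V) :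
    f.toLinearEquiv (nprod n u v) = nprod n (f.toLinearEquiv u) (f.toLinearEquiv v) :=
  f.map_nprod' n u v

/-- The underlying homomorphism. -/
def toHom (f : VertexAlgEquiv R V W) : VertexAlgHom R V W where
  toLinearMap := f.toLinearEquiv.toLinearMap
  map_vac' := f.map_vac'
  map_nprod' := f.map_nprod'

variable (R V) in
/-- The identity. -/
def refl : VertexAlgEquiv R V V where
  toLinearEquiv := LinearEquiv.refl R V
  map_vac' := rfl
  map_nprod' _ _ _ := rfl

/-- The inverse. -/
def symm (f : VertexAlgEquiv R V W) : VertexAlgEquiv R W V where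
  toLinearEquiv := f.toLinearEquiv.symm
  map_vac' := by
    change f.toLinearEquiv.symm vac = vac
    rw [LinearEquiv.symm_apply_eq, f.map_vac]
  map_nprod' n u v := by
    change f.toLinearEquiv.symm (nprod n u v) =
      nprod n (f.toLinearEquiv.symm u) (f.toLinearEquiv.symm v)
    rw [LinearEquiv.symm_apply_eq, f.map_nprod]
    simp

/-- The composite `g ∘ f`. -/
def trans (f : VertexAlgEquiv R U V) (g : VertexAlgEquiv R V W) : VertexAlgEquiv R U W where
  toLinearEquiv := f.toLinearEquiv.trans g.toLinearEquiv
  map_vac' := (g.toHom.comp f.toHom).map_vac'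
  map_nprod' := (g.toHom.comp f.toHom).map_nprod'

/-- An isomorphism from two mutually inverse homomorphisms. -/
def ofInverse (f : VertexAlgHom R V W) (g : VertexAlgHom R W V)
    (h1 : g.comp f = VertexAlgHom.id R V) (h2 : f.comp g = VertexAlgHom.id R W) :
    VertexAlgEquiv R V W where
  toLinearEquiv := LinearEquiv.ofLinearMap f.toLinearMap g.toLinearMap
    (congrArg VertexAlgHom.toLinearMap h2) (congrArg VertexAlgHom.toLinearMap h1)
  map_vac' := f.map_vac'
  map_nprod' := f.map_nprod'

theorem symm_toHom_comp_toHom (f : VertexAlgEquiv R V W) :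
    f.symm.toHom.comp f.toHom = VertexAlgHom.id R V :=
  VertexAlgHom.ext fun v => f.toLinearEquiv.symm_apply_apply v

theorem toHom_comp_symm_toHom (f : VertexAlgEquiv R V W) :
    f.toHom.comp f.symm.toHom = VertexAlgHom.id R W :=
  VertexAlgHom.ext fun v => f.toLinearEquiv.apply_symm_apply v

theorem toHom_injective : Function.Injective (toHom : VertexAlgEquiv R V W → VertexAlgHom R V W) :=
  fun _ _ h => ext fun v => LinearMap.congr_fun (congrArg VertexAlgHom.toLinearMap h) v

/-- The automorphism group, with composition as multiplication. -/
instance instGroup : Group (VertexAlgEquiv R V V) where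
  mul f g := g.trans f
  one := refl R V
  inv f := f.symm
  mul_assoc _ _ _ := rfl
  one_mul _ := rfl
  mul_one _ := rfl
  inv_mul_cancel f := ext fun v => f.toLinearEquiv.symm_apply_apply v

theorem symm_trans_mul_symm_trans (f g h : VertexAlgEquiv R W V) :
    (g.symm.trans h) * (f.symm.trans g) = f.symm.trans h := by
  refine ext fun v => ?_
  change h.toLinearEquiv (g.toLinearEquiv.symm (g.toLinearEquiv _)) = h.toLinearEquiv _
  rw [LinearEquiv.symm_apply_apply]

theorem mul_apply (f g : VertexAlgEquiv R V V) (v : V) :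
    (f * g).toLinearEquiv v = f.toLinearEquiv (g.toLinearEquiv v) := rfl

end VertexAlgEquiv

namespace BaseChange

open VertexRing CommVertexRing VertexAlgebra

variable {R S V : Type*} [CommRing R] [CommVertexRing R] [CommRing S] [CommVertexRing S]
  [Algebra R S] [VertexAlgebra R S] [AddCommGroup V] [VertexRing V] [Module R V]
  [VertexAlgebra R V]

/-- The `R`-linear map `v ↦ ∑ⱼ Dⱼ(s) ⊗ uₙ₊ⱼ v`. -/
noncomputable def opAux (n : ℤ) (s : S) (u : V) : V →ₗ[R] S ⊗[R] V where
  toFun v := ∑ᶠ j : ℕ, hasse j s ⊗ₜ[R] nprod (n + j) u v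
  map_add' v w := by
    obtain ⟨N, hN⟩ := exists_nat_bound u v n
    obtain ⟨M, hM⟩ := exists_nat_bound u w n
    rw [finsum_nat_eq_sum_range (max N M), finsum_nat_eq_sum_range (max N M),
      finsum_nat_eq_sum_range (max N M), ← Finset.sum_add_distrib]
    · simp [TensorProduct.tmul_add]
    all_goals intro i hi
    · rw [hM i (by omega), TensorProduct.tmul_zero]
    · rw [hN i (by omega), TensorProduct.tmul_zero]
    · rw [map_add, hM i (by omega), hN i (by omega), add_zero, TensorProduct.tmul_zero]
  map_smul' r v := by
    obtain ⟨N, hN⟩ := exists_nat_bound u v n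
    rw [finsum_nat_eq_sum_range N, finsum_nat_eq_sum_range N, Finset.smul_sum]
    · simp [nprod_smul]
    all_goals intro i hi
    · rw [hN i hi, TensorProduct.tmul_zero]
    · rw [nprod_smul, hN i hi, smul_zero, TensorProduct.tmul_zero]

theorem opAux_apply (n : ℤ) (s : S) (u v : V) (N : ℕ)
    (hN : ∀ j : ℕ, N ≤ j → nprod (n + j) u v = 0) :
    opAux (R := R) n s u v = ∑ j ∈ Finset.range N, hasse j s ⊗ₜ[R] nprod (n + j) u v :=
  finsum_nat_eq_sum_range N fun i hi => by rw [hN i hi, TensorProduct.tmul_zero]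

theorem opAux_add_left (n : ℤ) (s t : S) (u : V) :
    opAux (R := R) n (s + t) u = opAux n s u + opAux n t u := by
  ext v
  obtain ⟨N, hN⟩ := exists_nat_bound u v n
  rw [LinearMap.add_apply, opAux_apply n _ u v N hN, opAux_apply n _ u v N hN,
    opAux_apply n _ u v N hN, ← Finset.sum_add_distrib]
  simp [TensorProduct.add_tmul]

theorem opAux_add_right (n : ℤ) (s : S) (u w : V) :
    opAux (R := R) n s (u + w) = opAux n s u + opAux n s w := by
  ext v
  obtain ⟨N, hN⟩ := exists_nat_bound u v n
  obtain ⟨M, hM⟩ := exists_nat_bound w v n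
  rw [LinearMap.add_apply, opAux_apply n _ u v (max N M), opAux_apply n _ w v (max N M),
    opAux_apply n _ (u + w) v (max N M), ← Finset.sum_add_distrib]
  · simp [TensorProduct.tmul_add]
  all_goals intro i hi
  · simp [hM i (by omega), hN i (by omega)]
  · exact hM i (by omega)
  · exact hN i (by omega)

theorem opAux_smul (n : ℤ) (r : R) (s : S) (u : V) :
    opAux (R := R) n (r • s) u = opAux n s (r • u) := by
  ext v
  obtain ⟨N, hN⟩ := exists_nat_bound u v n
  have hN' : ∀ k j : ℕ, N ≤ k + j → nprod (n + k + j) u v = 0 := fun k j h => by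
    have := hN (k + j) h
    push_cast at this
    rwa [add_assoc]
  have hN2 : ∀ j : ℕ, N ≤ j → nprod (n + j) (r • u) v = 0 := fun j hj => by
    rw [smul_nprod _ r u v 0 fun k _ => hN' j k (by omega)]
    simp
  have hs : ∀ k : ℕ, hasse k (r • s) =
      ∑ x ∈ Finset.HasAntidiagonal.antidiagonal k, hasse x.1 r • hasse x.2 s := fun k => by
    rw [Algebra.smul_def, hasse_mul]
    refine Finset.sum_congr rfl fun x _ => ?_
    rw [Algebra.algebraMap_eq_smul_one, one_eq_vac (R := S), hasse_smul_vac (R := R) (V := S),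
      ← one_eq_vac (R := S), Algebra.smul_mul_assoc, one_mul]
  rw [opAux_apply n _ u v N hN, opAux_apply n _ _ v N hN2]
  have h1 := sum_range_antidiagonal
    (fun p q => (hasse p r • hasse q s) ⊗ₜ[R] nprod (n + (p + q : ℕ)) u v) N N N le_rfl le_rfl
    (fun p q h => by rw [hN _ h, TensorProduct.tmul_zero])
  calc _ = _ := ?_
    _ = _ := h1
    _ = _ := ?_
  · refine Finset.sum_congr rfl fun k _ => ?_
    rw [hs, TensorProduct.sum_tmul]
    refine Finset.sum_congr rfl fun x hx => ?_
    rw [Finset.HasAntidiagonal.mem_antidiagonal.mp hx]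
  · rw [Finset.sum_comm]
    refine Finset.sum_congr rfl fun q _ => ?_
    rw [smul_nprod _ r u v N fun k hk => hN' q k (by omega), TensorProduct.tmul_sum]
    refine Finset.sum_congr rfl fun p _ => ?_
    rw [TensorProduct.smul_tmul]
    have e : n + ((p + q : ℕ) : ℤ) = n + q + p := by push_cast; ring
    rw [e]

variable (R S V) in
/-- The `n`-th product of the base change `S ⊗ V` (written with the new base on the left), given by
`(s ⊗ u)ₙ (t ⊗ v) = ∑ⱼ Dⱼ(s) t ⊗ uₙ₊ⱼ v`; see `nprod_tmul`. -/
noncomputable def nprod (n : ℤ) : S ⊗[R] V →+ S ⊗[R] V →+ S ⊗[R] V :=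
  TensorProduct.liftAddHom
    { toFun := fun s =>
        { toFun := fun u => (LinearMap.liftBaseChange S (opAux (R := R) n s u)).toAddMonoidHom
          map_zero' := by
            have : opAux (R := R) n s (0 : V) = 0 := by
              ext v
              simpa using opAux_apply (R := R) n s (0 : V) v 0 (by simp)
            rw [this]; ext; simp
          map_add' := fun u w => by
            rw [opAux_add_right]
            ext x; simp [map_add] }
      map_zero' := by
        ext u x
        have : opAux (R := R) n (0 : S) u = 0 := by
          ext v
          obtain ⟨N, hN⟩ := exists_nat_bound u v n
          simpa using opAux_apply (R := R) n (0 : S) u v N hN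
        simp [this]
      map_add' := fun s t => by
        ext u x
        simp [opAux_add_left] }
    fun r s u => by
      simp [opAux_smul]

theorem nprod_tmul' (n : ℤ) (s t : S) (u v : V) :
    nprod R S V n (s ⊗ₜ u) (t ⊗ₜ v) = t • opAux (R := R) n s u v := by
  simp [nprod]

theorem nprod_tmul_right (n : ℤ) (s t : S) (u : V) (x : S ⊗[R] V) :
    nprod R S V n (s ⊗ₜ u) (t • x) = t • nprod R S V n (s ⊗ₜ u) x := by
  simp [nprod]

theorem nprod_tmul (n : ℤ) (s t : S) (u v : V) (N : ℕ)
    (hN : ∀ j : ℕ, N ≤ j → VertexRing.nprod (n + j) u v = 0) :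
    nprod R S V n (s ⊗ₜ u) (t ⊗ₜ v) =
      ∑ j ∈ Finset.range N, (hasse j s * t) ⊗ₜ[R] VertexRing.nprod (n + j) u v := by
  rw [nprod_tmul', opAux_apply n s u v N hN, Finset.smul_sum]
  simp [TensorProduct.smul_tmul', mul_comm]

end BaseChange

namespace BaseChange

open VertexRing CommVertexRing VertexAlgebra

/-- The Jacobi identity for given elements. -/
def Jac {M : Type*} [AddCommGroup M] (P : ℤ → M →+ M →+ M) (u v w : M) : Prop :=
  ∀ l m n : ℤ, ∑ᶠ i : ℕ, Ring.choose m i • P (m + n - i) (P (l + i) u v) w =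
      ∑ᶠ i : ℕ, ((-1) ^ i * Ring.choose l i) •
        (P (m + l - i) u (P (n + i) v w) - (l.negOnePow : ℤ) • P (n + l - i) v (P (m + i) u w))

theorem jac_iff {M : Type*} [AddCommGroup M] (P : ℤ → M →+ M →+ M) (u v w : M) (l m n : ℤ)
    (N : ℕ) (h1 : ∀ j : ℕ, N ≤ j → P (l + j) u v = 0) (h2 : ∀ j : ℕ, N ≤ j → P (n + j) v w = 0)
    (h3 : ∀ j : ℕ, N ≤ j → P (m + j) u w = 0) :
    (∑ᶠ i : ℕ, Ring.choose m i • P (m + n - i) (P (l + i) u v) w =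
      ∑ᶠ i : ℕ, ((-1) ^ i * Ring.choose l i) •
        (P (m + l - i) u (P (n + i) v w) - (l.negOnePow : ℤ) • P (n + l - i) v (P (m + i) u w))) ↔
    (∑ i ∈ Finset.range N, Ring.choose m i • P (m + n - i) (P (l + i) u v) w =
      ∑ i ∈ Finset.range N, ((-1) ^ i * Ring.choose l i) •
        (P (m + l - i) u (P (n + i) v w) -
          (l.negOnePow : ℤ) • P (n + l - i) v (P (m + i) u w))) := by
  rw [finsum_nat_eq_sum_range N, finsum_nat_eq_sum_range N]
  · intro i hi
    simp [h2 i hi, h3 i hi]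
  · intro i hi
    simp [h1 i hi]

section

variable {M : Type*} [AddCommGroup M] {P : ℤ → M →+ M →+ M}

theorem bound_nat (hP : ∀ u v : M, ∃ N : ℤ, ∀ n : ℤ, N ≤ n → P n u v = 0) (u v : M) (n : ℤ) :
    ∃ N : ℕ, ∀ j : ℕ, N ≤ j → P (n + j) u v = 0 := by
  obtain ⟨N, hN⟩ := hP u v
  exact ⟨(N - n).toNat, fun j hj => hN _ (by omega)⟩

theorem jac_add (hP : ∀ u v : M, ∃ N : ℤ, ∀ n : ℤ, N ≤ n → P n u v = 0) {u u' v v' w w' : M} :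
    (Jac P u v w → Jac P u' v w → Jac P (u + u') v w) ∧
    (Jac P u v w → Jac P u v' w → Jac P u (v + v') w) ∧
    (Jac P u v w → Jac P u v w' → Jac P u v (w + w')) := by
  refine ⟨?_, ?_, ?_⟩
  · intro h h' l m n
    obtain ⟨N1, hN1⟩ := bound_nat hP u v l
    obtain ⟨N2, hN2⟩ := bound_nat hP u' v l
    obtain ⟨N3, hN3⟩ := bound_nat hP v w n
    obtain ⟨N4, hN4⟩ := bound_nat hP u w m
    obtain ⟨N5, hN5⟩ := bound_nat hP u' w m
    have e := (jac_iff P u v w l m n (N1 + N2 + N3 + N4 + N5) (fun j hj => hN1 j (by omega))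
      (fun j hj => hN3 j (by omega)) (fun j hj => hN4 j (by omega))).mp (h l m n)
    have e' := (jac_iff P u' v w l m n (N1 + N2 + N3 + N4 + N5) (fun j hj => hN2 j (by omega))
      (fun j hj => hN3 j (by omega)) (fun j hj => hN5 j (by omega))).mp (h' l m n)
    refine (jac_iff P (u + u') v w l m n (N1 + N2 + N3 + N4 + N5)
      (fun j hj => by simp [hN1 j (by omega), hN2 j (by omega)])
      (fun j hj => hN3 j (by omega))
      (fun j hj => by simp [hN4 j (by omega), hN5 j (by omega)])).mpr ?_
    simp only [map_add, AddMonoidHom.add_apply, smul_add, Finset.sum_add_distrib, e, e']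
    rw [← Finset.sum_add_distrib]
    refine Finset.sum_congr rfl fun i _ => ?_
    module
  · intro h h' l m n
    obtain ⟨N1, hN1⟩ := bound_nat hP u v l
    obtain ⟨N2, hN2⟩ := bound_nat hP u v' l
    obtain ⟨N3, hN3⟩ := bound_nat hP v w n
    obtain ⟨N4, hN4⟩ := bound_nat hP u w m
    obtain ⟨N5, hN5⟩ := bound_nat hP v' w n
    have e := (jac_iff P u v w l m n (N1 + N2 + N3 + N4 + N5) (fun j hj => hN1 j (by omega))
      (fun j hj => hN3 j (by omega)) (fun j hj => hN4 j (by omega))).mp (h l m n)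
    have e' := (jac_iff P u v' w l m n (N1 + N2 + N3 + N4 + N5) (fun j hj => hN2 j (by omega))
      (fun j hj => hN5 j (by omega)) (fun j hj => hN4 j (by omega))).mp (h' l m n)
    refine (jac_iff P u (v + v') w l m n (N1 + N2 + N3 + N4 + N5)
      (fun j hj => by simp [hN1 j (by omega), hN2 j (by omega)])
      (fun j hj => by simp [hN3 j (by omega), hN5 j (by omega)])
      (fun j hj => hN4 j (by omega))).mpr ?_
    simp only [map_add, AddMonoidHom.add_apply, smul_add, Finset.sum_add_distrib, e, e']
    rw [← Finset.sum_add_distrib]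
    refine Finset.sum_congr rfl fun i _ => ?_
    module
  · intro h h' l m n
    obtain ⟨N1, hN1⟩ := bound_nat hP u v l
    obtain ⟨N2, hN2⟩ := bound_nat hP u w' m
    obtain ⟨N3, hN3⟩ := bound_nat hP v w n
    obtain ⟨N4, hN4⟩ := bound_nat hP u w m
    obtain ⟨N5, hN5⟩ := bound_nat hP v w' n
    have e := (jac_iff P u v w l m n (N1 + N2 + N3 + N4 + N5) (fun j hj => hN1 j (by omega))
      (fun j hj => hN3 j (by omega)) (fun j hj => hN4 j (by omega))).mp (h l m n)
    have e' := (jac_iff P u v w' l m n (N1 + N2 + N3 + N4 + N5) (fun j hj => hN1 j (by omega))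
      (fun j hj => hN5 j (by omega)) (fun j hj => hN2 j (by omega))).mp (h' l m n)
    refine (jac_iff P u v (w + w') l m n (N1 + N2 + N3 + N4 + N5)
      (fun j hj => hN1 j (by omega))
      (fun j hj => by simp [hN3 j (by omega), hN5 j (by omega)])
      (fun j hj => by simp [hN2 j (by omega), hN4 j (by omega)])).mpr ?_
    simp only [map_add, smul_add, Finset.sum_add_distrib, e, e']
    rw [← Finset.sum_add_distrib]
    refine Finset.sum_congr rfl fun i _ => ?_
    module

theorem exists_uniform_bound (N : ℕ) (p : ℕ → ℕ → Prop)
    (h : ∀ i, ∃ M, ∀ k, M ≤ k → p i k) : ∃ M, ∀ i, i < N → ∀ k, M ≤ k → p i k := by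
  choose f hf using h
  refine ⟨∑ i ∈ Finset.range N, f i, fun i hi k hk => hf i k (le_trans ?_ hk)⟩
  exact Finset.single_le_sum (f := f) (fun _ _ => Nat.zero_le _) (Finset.mem_range.mpr hi)

theorem sum_range_shift {g : ℕ → M} (j K A : ℕ) (hA : j + K ≤ A) (h1 : ∀ e, e < j → g e = 0)
    (h2 : ∀ e, j + K ≤ e → g e = 0) :
    ∑ e ∈ Finset.range A, g e = ∑ p ∈ Finset.range K, g (p + j) := by
  symm
  refine Finset.sum_of_injOn (fun p => p + j) ?_ ?_ ?_ ?_
  · intro a _ b _ h; simpa using h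
  · intro a ha
    simp at ha ⊢
    omega
  · intro e _ h
    by_cases h3 : e < j
    · exact h1 e h3
    · apply h2
      by_contra hc
      exact h ⟨e - j, by simp; omega, by simp; omega⟩
  · intros; rfl

end

variable {R S V : Type*} [CommRing R] [CommVertexRing R] [CommRing S] [CommVertexRing S]
  [Algebra R S] [VertexAlgebra R S] [AddCommGroup V] [VertexRing V] [Module R V]
  [VertexAlgebra R V]

theorem nprod_regular (x y : S ⊗[R] V) : ∃ N : ℤ, ∀ n : ℤ, N ≤ n → nprod R S V n x y = 0 := by
  induction x with
  | zero => exact ⟨0, by simp⟩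
  | add x x' hx hx' =>
    obtain ⟨N, hN⟩ := hx
    obtain ⟨N', hN'⟩ := hx'
    exact ⟨max N N', fun n hn => by simp [hN n (by omega), hN' n (by omega)]⟩
  | tmul s u =>
    induction y with
    | zero => exact ⟨0, by simp⟩
    | add x x' hx hx' =>
      obtain ⟨N, hN⟩ := hx
      obtain ⟨N', hN'⟩ := hx'
      exact ⟨max N N', fun n hn => by simp [hN n (by omega), hN' n (by omega)]⟩
    | tmul t v =>
      obtain ⟨N, hN⟩ := regularity u v
      exact ⟨N, fun n hn => by
        rw [nprod_tmul n s t u v 0 fun j _ => hN _ (by omega), Finset.sum_range_zero]⟩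

theorem lhs_inner (s t a : S) (x w : V) (j : ℕ) (c : ℤ) (M A B : ℕ) (hA : M ≤ A) (hB : M ≤ B)
    (hM : ∀ k : ℕ, M ≤ k → VertexRing.nprod (c + k) x w = 0) :
    nprod R S V c ((hasse j s * t) ⊗ₜ x) (a ⊗ₜ w) =
      ∑ p ∈ Finset.range A, ∑ q ∈ Finset.range B, ((p + j).choose p : ℤ) •
        ((hasse (p + j) s * hasse q t * a) ⊗ₜ[R] VertexRing.nprod (c + (p + q : ℕ)) x w) := by
  rw [nprod_tmul c _ _ _ _ M hM, ← sum_range_antidiagonal _ M A B hA hB]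
  · refine Finset.sum_congr rfl fun k _ => ?_
    rw [hasse_mul, Finset.sum_mul, TensorProduct.sum_tmul]
    refine Finset.sum_congr rfl fun x hx => ?_
    rw [Finset.HasAntidiagonal.mem_antidiagonal.mp hx, hasse_hasse, natCast_zsmul,
      TensorProduct.smul_tmul', smul_mul_assoc, smul_mul_assoc]
  · intro p q h
    rw [hM _ h, TensorProduct.tmul_zero, smul_zero]

theorem jac_tmul (s t a : S) (u v w : V) : Jac (nprod R S V) (s ⊗ₜ u) (t ⊗ₜ v) (a ⊗ₜ w) := by
  intro l m n
  obtain ⟨N1, hN1⟩ := exists_nat_bound u v l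
  obtain ⟨N2, hN2⟩ := exists_nat_bound v w n
  obtain ⟨N3, hN3⟩ := exists_nat_bound u w m
  obtain ⟨N, hN1', hN2', hN3'⟩ : ∃ N, N1 ≤ N ∧ N2 ≤ N ∧ N3 ≤ N :=
    ⟨N1 + N2 + N3, by omega, by omega, by omega⟩
  have b1 : ∀ i j : ℕ, N ≤ i + j → VertexRing.nprod (l + i + j) u v = 0 := fun i j h => by
    have := hN1 (i + j) (by omega)
    rwa [Nat.cast_add, ← add_assoc] at this
  have b2 : ∀ i j : ℕ, N ≤ i + j → VertexRing.nprod (n + i + j) v w = 0 := fun i j h => by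
    have := hN2 (i + j) (by omega)
    rwa [Nat.cast_add, ← add_assoc] at this
  have b3 : ∀ i j : ℕ, N ≤ i + j → VertexRing.nprod (m + i + j) u w = 0 := fun i j h => by
    have := hN3 (i + j) (by omega)
    rwa [Nat.cast_add, ← add_assoc] at this
  obtain ⟨M1, hM1⟩ := exists_uniform_bound N
    (fun I k => VertexRing.nprod (m + n - N + k) (VertexRing.nprod (l + I) u v) w = 0) (fun I => exists_nat_bound _ _ _)
  obtain ⟨M2, hM2⟩ := exists_uniform_bound N
    (fun I k => VertexRing.nprod (m + l - N + k) u (VertexRing.nprod (n + I) v w) = 0) (fun I => exists_nat_bound _ _ _)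
  obtain ⟨M3, hM3⟩ := exists_uniform_bound N
    (fun I k => VertexRing.nprod (n + l - N + k) v (VertexRing.nprod (m + I) u w) = 0) (fun I => exists_nat_bound _ _ _)
  obtain ⟨M, hM1', hM2', hM3'⟩ : ∃ M, M1 ≤ M ∧ M2 ≤ M ∧ M3 ≤ M :=
    ⟨M1 + M2 + M3, by omega, by omega, by omega⟩
  have c1 : ∀ i j i' k : ℕ, i' ≤ i + j → M ≤ k →
      VertexRing.nprod (m + n - i' + k) (VertexRing.nprod (l + i + j) u v) w = 0 := fun i j i' k hi hk => by
    by_cases h : N ≤ i + j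
    · rw [b1 i j h]; simp
    · have := hM1 (i + j) (by omega) (N - i' + k) (by omega)
      rw [Nat.cast_add, Nat.cast_add, Nat.cast_sub (by omega), ← add_assoc] at this
      rw [show m + n - (i' : ℤ) + k = m + n - N + (N - i') + k by ring, add_assoc l]
      exact this
  have c2 : ∀ i j k : ℕ, M ≤ k →
      VertexRing.nprod (m + l - i + k) u (VertexRing.nprod (n + i + j) v w) = 0 := fun i j k hk => by
    by_cases h : N ≤ i + j
    · rw [b2 i j h]; simp
    · have := hM2 (i + j) (by omega) (N - i + k) (by omega)
      rw [Nat.cast_add, Nat.cast_add, Nat.cast_sub (by omega), ← add_assoc] at this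
      rw [show m + l - (i : ℤ) + k = m + l - N + (N - i) + k by ring, add_assoc n]
      exact this
  have c3 : ∀ i j k : ℕ, M ≤ k →
      VertexRing.nprod (n + l - i + k) v (VertexRing.nprod (m + i + j) u w) = 0 := fun i j k hk => by
    by_cases h : N ≤ i + j
    · rw [b3 i j h]; simp
    · have := hM3 (i + j) (by omega) (N - i + k) (by omega)
      rw [Nat.cast_add, Nat.cast_add, Nat.cast_sub (by omega), ← add_assoc] at this
      rw [show n + l - (i : ℤ) + k = n + l - N + (N - i) + k by ring, add_assoc m]
      exact this
  rw [jac_iff (nprod R S V) _ _ _ l m n N]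
  rotate_left
  · intro j hj
    rw [nprod_tmul _ _ _ _ _ 0 fun k _ => b1 j k (by omega), Finset.sum_range_zero]
  · intro j hj
    rw [nprod_tmul _ _ _ _ _ 0 fun k _ => b2 j k (by omega), Finset.sum_range_zero]
  · intro j hj
    rw [nprod_tmul _ _ _ _ _ 0 fun k _ => b3 j k (by omega), Finset.sum_range_zero]
  -- the common value, first form
  have key1 : ∑ i ∈ Finset.range N, Ring.choose m i •
        nprod R S V (m + n - i) (nprod R S V (l + i) (s ⊗ₜ u) (t ⊗ₜ v)) (a ⊗ₜ w) =
      ∑ e ∈ Finset.range (M + N), ∑ q ∈ Finset.range (M + N), (hasse e s * hasse q t * a) ⊗ₜ[R]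
        ∑ I ∈ Finset.range N, Ring.choose (m + e) I •
          VertexRing.nprod (m + e + (n + q) - I) (VertexRing.nprod (l + I) u v) w := by
    have step1 : ∀ i ∈ Finset.range N, Ring.choose m i •
        nprod R S V (m + n - i) (nprod R S V (l + i) (s ⊗ₜ u) (t ⊗ₜ v)) (a ⊗ₜ w) =
        ∑ j ∈ Finset.range N, ∑ q ∈ Finset.range (M + N), ∑ p ∈ Finset.range M,
          (Ring.choose m i * ((p + j).choose p : ℤ)) •
          ((hasse (p + j) s * hasse q t * a) ⊗ₜ[R]
            VertexRing.nprod (m + n - i + (p + q : ℕ)) (VertexRing.nprod (l + i + j) u v) w) := fun i _ => by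
      rw [nprod_tmul (l + i) s t u v N fun j hj => b1 i j (by omega), map_sum,
        AddMonoidHom.finsetSum_apply, Finset.smul_sum]
      refine Finset.sum_congr rfl fun j _ => ?_
      rw [lhs_inner s t a _ w j (m + n - i) M M (M + N) le_rfl (by omega)
        fun k hk => c1 i j i k (by omega) hk, Finset.sum_comm, Finset.smul_sum]
      refine Finset.sum_congr rfl fun q _ => ?_
      rw [Finset.smul_sum]
      simp only [mul_smul]
    have step2 : ∀ e q : ℕ, ∑ I ∈ Finset.range N, Ring.choose (m + e) I •
          VertexRing.nprod (m + e + (n + q) - I) (VertexRing.nprod (l + I) u v) w =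
        ∑ i ∈ Finset.range N, ∑ j ∈ Finset.range N, (Ring.choose m i * (e.choose j : ℤ)) •
          VertexRing.nprod (m + e + (n + q) - (i + j : ℕ)) (VertexRing.nprod (l + i + j) u v) w := fun e q => by
      rw [← sum_range_antidiagonal _ N N N le_rfl le_rfl]
      · refine Finset.sum_congr rfl fun I _ => ?_
        rw [Ring.add_choose_eq I (Commute.all _ _), Finset.sum_smul]
        refine Finset.sum_congr rfl fun x hx => ?_
        rw [Ring.choose_natCast, add_assoc l, ← Nat.cast_add,
          Finset.HasAntidiagonal.mem_antidiagonal.mp hx]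
      · intro i j h
        rw [b1 i j h]; simp
    simp only [step2, TensorProduct.tmul_sum]
    rw [Finset.sum_congr rfl step1]
    have comm : ∀ F : ℕ → ℕ → ℕ → ℕ → S ⊗[R] V,
        ∑ e ∈ Finset.range (M + N), ∑ q ∈ Finset.range (M + N), ∑ i ∈ Finset.range N,
          ∑ j ∈ Finset.range N, F e q i j =
        ∑ i ∈ Finset.range N, ∑ j ∈ Finset.range N, ∑ q ∈ Finset.range (M + N),
          ∑ e ∈ Finset.range (M + N), F e q i j := fun F => by
      rw [Finset.sum_comm]
      simp only [Finset.sum_comm (s := Finset.range (M + N)) (t := Finset.range N)]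
    rw [comm]
    refine Finset.sum_congr rfl fun i hi => Finset.sum_congr rfl fun j hj =>
      Finset.sum_congr rfl fun q _ => ?_
    rw [Finset.mem_range] at hi hj
    rw [sum_range_shift j M (M + N) (by omega)]
    · refine Finset.sum_congr rfl fun p _ => ?_
      rw [TensorProduct.tmul_smul, Nat.choose_symm_add]
      congr 5
      push_cast; ring
    · intro e he
      rw [Nat.choose_eq_zero_of_lt he]; simp
    · intro e he
      have := c1 i j i (q + (e - j)) (by omega) (by omega)
      rw [Nat.cast_add, Nat.cast_sub (by omega)] at this
      have e1 : m + e + (n + q) - ((i + j : ℕ) : ℤ) = m + n - i + (q + (e - j)) := by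
        push_cast; ring
      rw [e1, this]; simp
  have key2 : ∀ e q : ℕ, ∑ I ∈ Finset.range N, Ring.choose (m + e) I •
          VertexRing.nprod (m + e + (n + q) - I) (VertexRing.nprod (l + I) u v) w =
      ∑ i ∈ Finset.range N, ((-1) ^ i * Ring.choose l i) •
        (VertexRing.nprod (m + e + l - i) u (VertexRing.nprod (n + q + i) v w) -
          (l.negOnePow : ℤ) • VertexRing.nprod (n + q + l - i) v (VertexRing.nprod (m + e + i) u w)) := fun e q => by
    rw [← jac_iff VertexRing.nprod u v w l (m + e) (n + q) N (fun j hj => by simpa using b1 0 j (by omega))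
      (fun j hj => b2 q j (by omega)) (fun j hj => b3 e j (by omega))]
    exact jacobi u v w l (m + e) (n + q)
  rw [key1]
  simp only [key2, TensorProduct.tmul_sum]
  have comm : ∀ F : ℕ → ℕ → ℕ → S ⊗[R] V,
      ∑ e ∈ Finset.range (M + N), ∑ q ∈ Finset.range (M + N), ∑ i ∈ Finset.range N, F e q i =
      ∑ i ∈ Finset.range N, ∑ e ∈ Finset.range (M + N), ∑ q ∈ Finset.range (M + N),
        F e q i := fun F => by
    simp only [Finset.sum_comm (s := Finset.range (M + N)) (t := Finset.range N)]
  rw [comm]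
  refine Finset.sum_congr rfl fun i _ => ?_
  rw [nprod_tmul (n + i) t a v w (M + N) fun j hj => b2 i j (by omega),
    nprod_tmul (m + i) s a u w (M + N) fun j hj => b3 i j (by omega), map_sum, map_sum]
  have r1 : ∀ q : ℕ, nprod R S V (m + l - i) (s ⊗ₜ u) ((hasse q t * a) ⊗ₜ[R] VertexRing.nprod (n + i + q) v w) =
      ∑ e ∈ Finset.range (M + N), (hasse e s * hasse q t * a) ⊗ₜ[R]
        VertexRing.nprod (m + l - i + e) u (VertexRing.nprod (n + i + q) v w) := fun q => by
    rw [nprod_tmul _ _ _ _ _ (M + N) fun k hk => c2 i q k (by omega)]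
    simp only [mul_assoc]
  have r2 : ∀ e : ℕ, nprod R S V (n + l - i) (t ⊗ₜ v) ((hasse e s * a) ⊗ₜ[R] VertexRing.nprod (m + i + e) u w) =
      ∑ q ∈ Finset.range (M + N), (hasse e s * hasse q t * a) ⊗ₜ[R]
        VertexRing.nprod (n + l - i + q) v (VertexRing.nprod (m + i + e) u w) := fun e => by
    rw [nprod_tmul _ _ _ _ _ (M + N) fun k hk => c3 i e k (by omega)]
    refine Finset.sum_congr rfl fun q _ => ?_
    congr 1; ring
  simp only [r1, r2]
  rw [Finset.sum_comm (s := Finset.range (M + N)) (t := Finset.range (M + N))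
      (f := fun q e => (hasse e s * hasse q t * a) ⊗ₜ[R]
        VertexRing.nprod (m + l - i + e) u (VertexRing.nprod (n + i + q) v w)),
    Finset.smul_sum, ← Finset.sum_sub_distrib, Finset.smul_sum]
  refine Finset.sum_congr rfl fun e _ => ?_
  rw [Finset.smul_sum, ← Finset.sum_sub_distrib, Finset.smul_sum]
  refine Finset.sum_congr rfl fun q _ => ?_
  rw [TensorProduct.tmul_smul, TensorProduct.tmul_sub, TensorProduct.tmul_smul]
  have e1 : m + e + l - i = m + l - i + e := by ring
  have e2 : n + q + i = n + i + q := by ring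
  have e3 : n + q + l - i = n + l - i + q := by ring
  have e4 : m + e + i = m + i + e := by ring
  rw [e1, e2, e3, e4]

end BaseChange

namespace BaseChange

open VertexRing CommVertexRing VertexAlgebra

variable {R S T V W : Type*} [CommRing R] [CommVertexRing R] [CommRing S] [CommVertexRing S]
  [Algebra R S] [VertexAlgebra R S] [CommRing T] [CommVertexRing T]
  [Algebra R T] [VertexAlgebra R T] [AddCommGroup V] [VertexRing V] [Module R V]
  [VertexAlgebra R V] [AddCommGroup W] [VertexRing W] [Module R W] [VertexAlgebra R W]

theorem nprod_jac (x y z : S ⊗[R] V) : Jac (nprod R S V) x y z := by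
  have h0 : ∀ x y z : S ⊗[R] V, x = 0 ∨ y = 0 ∨ z = 0 → Jac (nprod R S V) x y z := by
    intro x y z h l m n
    rw [finsum_nat_eq_sum_range 0, finsum_nat_eq_sum_range 0]
    · simp
    all_goals
      intro i _
      rcases h with rfl | rfl | rfl <;> simp
  induction x with
  | zero => exact h0 _ _ _ (Or.inl rfl)
  | add x x' hx hx' => exact (jac_add (v' := 0) (w' := 0) nprod_regular).1 hx hx'
  | tmul s u =>
    induction y with
    | zero => exact h0 _ _ _ (Or.inr (Or.inl rfl))
    | add x x' hx hx' => exact (jac_add (u' := 0) (w' := 0) nprod_regular).2.1 hx hx'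
    | tmul t v =>
      induction z with
      | zero => exact h0 _ _ _ (Or.inr (Or.inr rfl))
      | add x x' hx hx' => exact (jac_add (u' := 0) (v' := 0) nprod_regular).2.2 hx hx'
      | tmul a w => exact jac_tmul s t a u v w

/-- The base change `S ⊗ V`, as a vertex ring. -/
noncomputable instance instVertexRing : VertexRing (S ⊗[R] V) where
  nprod := nprod R S V
  vac := 1 ⊗ₜ vac
  regularity := nprod_regular
  creation_of_nonneg x n hn := by
    induction x with
    | zero => simp
    | add x y hx hy => simp [hx, hy]
    | tmul s u =>
      rw [nprod_tmul n s 1 u vac 0 fun j _ => creation_of_nonneg _ _ (by omega)]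
      simp
  creation_neg_one x := by
    induction x with
    | zero => simp
    | add x y hx hy => simp [hx, hy]
    | tmul s u =>
      rw [nprod_tmul (-1) s 1 u vac 1 fun j _ => creation_of_nonneg _ _ (by omega)]
      simp [creation_neg_one]
  jacobi := nprod_jac

theorem vac_def : (vac : S ⊗[R] V) = 1 ⊗ₜ vac := rfl

theorem nprod_tmul_tmul (n : ℤ) (s t : S) (u v : V) (N : ℕ)
    (hN : ∀ j : ℕ, N ≤ j → VertexRing.nprod (n + j) u v = 0) :
    VertexRing.nprod n (s ⊗ₜ[R] u) (t ⊗ₜ[R] v) =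
      ∑ j ∈ Finset.range N, (hasse j s * t) ⊗ₜ[R] VertexRing.nprod (n + j) u v :=
  nprod_tmul n s t u v N hN

theorem nprod_one_tmul (n : ℤ) (t : S) (u v : V) :
    VertexRing.nprod n ((1 : S) ⊗ₜ[R] u) (t ⊗ₜ[R] v) = t ⊗ₜ VertexRing.nprod n u v := by
  obtain ⟨N, hN⟩ := exists_nat_bound u v n
  rw [nprod_tmul_tmul n 1 t u v (N + 1) fun j hj => hN j (by omega), Finset.sum_range_succ',
    Finset.sum_eq_zero]
  · simp
  · intro j _
    rw [hasse_one _ (by omega)]; simp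

theorem nprod_smul_right (n : ℤ) (t : S) (x y : S ⊗[R] V) :
    VertexRing.nprod n x (t • y) = t • VertexRing.nprod n x y := by
  induction x with
  | zero => simp
  | add x x' hx hx' => simp [hx, hx']
  | tmul s u => exact nprod_tmul_right n s t u y

theorem nprod_tmul_vac (k : ℕ) (s : S) (x : S ⊗[R] V) :
    VertexRing.nprod (-(k : ℤ) - 1) (s ⊗ₜ[R] (vac : V)) x = hasse k s • x := by
  induction x with
  | zero => simp
  | add x x' hx hx' => simp [hx, hx']
  | tmul t v =>
    rw [nprod_tmul_tmul _ s t vac v (k + 1) fun j hj => vac_nprod_of_ne _ _ (by omega),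
      Finset.sum_range_succ, Finset.sum_eq_zero]
    · have : -(k : ℤ) - 1 + k = -1 := by ring
      rw [this, vac_nprod_neg_one, TensorProduct.smul_tmul', smul_eq_mul, zero_add]
    · intro j hj
      rw [Finset.mem_range] at hj
      rw [vac_nprod_of_ne _ _ (by omega), TensorProduct.tmul_zero]

theorem nprod_tmul_vac_of_nonneg (n : ℤ) (hn : 0 ≤ n) (s : S) (x : S ⊗[R] V) :
    VertexRing.nprod n (s ⊗ₜ[R] (vac : V)) x = 0 := by
  induction x with
  | zero => simp
  | add x x' hx hx' => simp [hx, hx']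
  | tmul t v =>
    rw [nprod_tmul_tmul _ s t vac v 0 fun j hj => vac_nprod_of_ne _ _ (by omega)]
    simp

theorem tmul_vac_mem_center (s : S) : s ⊗ₜ[R] (vac : V) ∈ center (S ⊗[R] V) := by
  intro u w m n
  rcases le_or_gt 0 m with hm | hm
  · rw [nprod_tmul_vac_of_nonneg m hm, nprod_tmul_vac_of_nonneg m hm, map_zero]
  · obtain ⟨k, rfl⟩ : ∃ k : ℕ, m = -(k : ℤ) - 1 := ⟨(-m - 1).toNat, by omega⟩
    rw [nprod_tmul_vac, nprod_tmul_vac, nprod_smul_right]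

theorem tmul_vac_nprod (s t : S) (n : ℤ) :
    VertexRing.nprod n s t ⊗ₜ[R] (vac : V) =
      VertexRing.nprod n (s ⊗ₜ[R] (vac : V)) (t ⊗ₜ[R] (vac : V)) := by
  rcases le_or_gt 0 n with hm | hm
  · rw [nprod_tmul_vac_of_nonneg n hm, nprod_of_nonneg _ _ _ hm, TensorProduct.zero_tmul]
  · obtain ⟨k, rfl⟩ : ∃ k : ℕ, n = -(k : ℤ) - 1 := ⟨(-n - 1).toNat, by omega⟩
    rw [nprod_tmul_vac, nprod_neg, TensorProduct.smul_tmul', smul_eq_mul]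

/-- The base change `S ⊗ V` is an `S`-vertex algebra, with `ι(s) = s ⊗ 𝟏`. -/
instance instVertexAlgebra : VertexAlgebra S (S ⊗[R] V) where
  nprod_smul_vac s t n := by
    simp only [vac_def, TensorProduct.smul_tmul', smul_eq_mul, mul_one]
    exact tmul_vac_nprod s t n
  smul_vac_mem_center s := by
    simp only [vac_def, TensorProduct.smul_tmul', smul_eq_mul, mul_one]
    exact tmul_vac_mem_center s
  smul_eq_nprod s x := by
    simp only [vac_def, TensorProduct.smul_tmul', smul_eq_mul, mul_one]
    have := nprod_tmul_vac (R := R) 0 s x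
    simpa using this.symm

/-- An `S`-vertex algebra is an `R`-vertex algebra by restriction of scalars. -/
theorem _root_.VertexAlgebra.restrictScalars (R S V : Type*) [CommRing R] [CommVertexRing R]
    [CommRing S] [CommVertexRing S] [Algebra R S] [VertexAlgebra R S] [AddCommGroup V]
    [VertexRing V] [Module R V] [Module S V] [IsScalarTower R S V] [VertexAlgebra S V] :
    VertexAlgebra R V := by
  have h : ∀ r : R, r • (vac : V) = (r • (vac : S)) • (vac : V) := fun r => by
    rw [← one_eq_vac (R := S), smul_assoc, one_smul]
  refine ⟨fun r s n => ?_, fun r => ?_, fun r v => ?_⟩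
  · rw [h, h, h, ← nprod_smul_vac (R := S), ← nprod_smul_vac (R := R) (V := S) r s n]
  · rw [h]; exact smul_vac_mem_center _
  · rw [h, ← smul_eq_nprod (R := S), ← one_eq_vac (R := S), smul_assoc, one_smul]

instance instVertexAlgebraBase : VertexAlgebra R (S ⊗[R] V) := VertexAlgebra.restrictScalars R S (S ⊗[R] V)

/-- For commutative `T`, the base change `S ⊗ T` is a commutative vertex ring, whose multiplication
is the usual one on a tensor product of algebras. -/
noncomputable instance instCommVertexRing : CommVertexRing (S ⊗[R] T) where
  toVertexRing := inferInstance
  one_eq_vac := by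
    rw [vac_def, Algebra.TensorProduct.one_def, one_eq_vac (R := T)]
  mem_center x := by
    rw [mem_center_iff]
    intro y n hn
    have : ∀ x y : S ⊗[R] T, VertexRing.nprod n x y = 0 := by
      intro x y
      induction x with
      | zero => simp
      | add x x' hx hx' => simp [hx, hx']
      | tmul s u =>
        induction y with
        | zero => simp
        | add x x' hx hx' => simp [hx, hx']
        | tmul t v =>
          rw [nprod_tmul_tmul _ s t u v 0 fun j hj => nprod_of_nonneg _ _ _ (by omega)]
          simp
    exact ⟨this _ _, this _ _⟩
  mul_eq_nprod x y := by
    induction x with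
    | zero => simp
    | add x x' hx hx' => simp [hx, hx', add_mul]
    | tmul s u =>
      induction y with
      | zero => simp
      | add x x' hx hx' => simp [hx, hx', mul_add]
      | tmul t v =>
        rw [nprod_tmul_tmul _ s t u v 1 fun j hj => nprod_of_nonneg _ _ _ (by omega)]
        simp [mul_eq_nprod]

end BaseChange

namespace VertexAlgHom

open VertexRing CommVertexRing VertexAlgebra BaseChange

variable {R S S' T V W U : Type*} [CommRing R] [CommVertexRing R]
  [CommRing S] [CommVertexRing S] [Algebra R S] [VertexAlgebra R S]
  [CommRing S'] [CommVertexRing S'] [Algebra R S'] [VertexAlgebra R S']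
  [CommRing T] [CommVertexRing T] [Algebra R T] [VertexAlgebra R T]
  [AddCommGroup U] [VertexRing U] [Module R U] [VertexAlgebra R U]
  [AddCommGroup V] [VertexRing V] [Module R V] [VertexAlgebra R V]
  [AddCommGroup W] [VertexRing W] [Module R W] [VertexAlgebra R W]

theorem map_mul (f : VertexAlgHom R S T) (s t : S) :
    f.toLinearMap (s * t) = f.toLinearMap s * f.toLinearMap t := by
  rw [mul_eq_nprod, map_nprod, mul_eq_nprod]

theorem map_one (f : VertexAlgHom R S T) : f.toLinearMap 1 = 1 := by
  rw [one_eq_vac (R := S), one_eq_vac (R := T), map_vac]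

/-- The homomorphism `f ⊗ g`. -/
noncomputable def tensorMap (f : VertexAlgHom R S S') (g : VertexAlgHom R V W) :
    VertexAlgHom R (S ⊗[R] V) (S' ⊗[R] W) where
  toLinearMap := TensorProduct.map f.toLinearMap g.toLinearMap
  map_vac' := by
    change TensorProduct.map f.toLinearMap g.toLinearMap (1 ⊗ₜ vac) = 1 ⊗ₜ vac
    rw [TensorProduct.map_tmul, map_one, map_vac]
  map_nprod' n x y := by
    change TensorProduct.map f.toLinearMap g.toLinearMap _ =
      VertexRing.nprod n (TensorProduct.map f.toLinearMap g.toLinearMap x)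
        (TensorProduct.map f.toLinearMap g.toLinearMap y)
    induction x with
    | zero => simp
    | add x x' hx hx' => simp only [map_add, AddMonoidHom.add_apply, hx, hx']
    | tmul s u =>
      induction y with
      | zero => simp
      | add x x' hx hx' => simp only [map_add, hx, hx']
      | tmul t v =>
        obtain ⟨N, hN⟩ := exists_nat_bound u v n
        rw [nprod_tmul_tmul n s t u v N hN, TensorProduct.map_tmul, TensorProduct.map_tmul,
          nprod_tmul_tmul n _ _ _ _ N fun j hj => by rw [← map_nprod, hN j hj, map_zero], map_sum]
        refine Finset.sum_congr rfl fun j _ => ?_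
        rw [TensorProduct.map_tmul, map_mul, map_hasse, map_nprod]

variable (R S V) in
/-- The homomorphism `v ↦ 1 ⊗ v`. -/
noncomputable def inr : VertexAlgHom R V (S ⊗[R] V) where
  toLinearMap := TensorProduct.mk R S V 1
  map_vac' := rfl
  map_nprod' n u v := (nprod_one_tmul n 1 u v).symm

variable (R S T) in
/-- The homomorphism `s ↦ s ⊗ 1`. -/
noncomputable def inl : VertexAlgHom R S (S ⊗[R] T) where
  toLinearMap := (TensorProduct.mk R S T).flip 1
  map_vac' := by
    change (vac : S) ⊗ₜ[R] (1 : T) = 1 ⊗ₜ vac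
    rw [one_eq_vac (R := S), one_eq_vac (R := T)]
  map_nprod' n s t := by
    change _ ⊗ₜ[R] (1 : T) = VertexRing.nprod n (s ⊗ₜ[R] (1 : T)) (t ⊗ₜ[R] (1 : T))
    rw [one_eq_vac (R := T)]
    exact tmul_vac_nprod s t n

/-- Restriction of scalars. -/
def restrictScalars (R : Type*) {S V W : Type*} [CommRing R] [CommVertexRing R] [CommRing S]
    [CommVertexRing S] [Algebra R S] [AddCommGroup V] [VertexRing V] [Module R V] [Module S V]
    [IsScalarTower R S V] [AddCommGroup W] [VertexRing W] [Module R W] [Module S W]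
    [IsScalarTower R S W] (φ : VertexAlgHom S V W) : VertexAlgHom R V W where
  toLinearMap := φ.toLinearMap.restrictScalars R
  map_vac' := φ.map_vac'
  map_nprod' := φ.map_nprod'

/-- The `S`-linear extension `s ⊗ v ↦ s • g(v)` of an `R`-homomorphism `g`. -/
noncomputable def liftBaseChange (S : Type*) [CommRing S] [CommVertexRing S] [Algebra R S]
    [VertexAlgebra R S] [Module S W] [IsScalarTower R S W]
    [VertexAlgebra S W] (g : VertexAlgHom R V W) : VertexAlgHom S (S ⊗[R] V) W where
  toLinearMap := g.toLinearMap.liftBaseChange S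
  map_vac' := by
    change g.toLinearMap.liftBaseChange S (1 ⊗ₜ vac) = vac
    rw [LinearMap.liftBaseChange_tmul, one_smul, map_vac]
  map_nprod' n x y := by
    change g.toLinearMap.liftBaseChange S _ =
      VertexRing.nprod n (g.toLinearMap.liftBaseChange S x) (g.toLinearMap.liftBaseChange S y)
    induction x with
    | zero => simp
    | add x x' hx hx' => simp only [map_add, AddMonoidHom.add_apply, hx, hx']
    | tmul s u =>
      induction y with
      | zero => simp
      | add x x' hx hx' => simp only [map_add, hx, hx']
      | tmul t v =>
        obtain ⟨N, hN⟩ := exists_nat_bound u v n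
        rw [nprod_tmul_tmul n s t u v N hN, LinearMap.liftBaseChange_tmul,
          LinearMap.liftBaseChange_tmul, nprod_smul,
          smul_nprod n s _ _ N fun j hj => by rw [← map_nprod, hN j hj, map_zero], map_sum,
          Finset.smul_sum]
        refine Finset.sum_congr rfl fun j _ => ?_
        rw [LinearMap.liftBaseChange_tmul, map_nprod, mul_comm, mul_smul]

/-- The base change of `φ : S ⊗ V → S ⊗ W` along `f : S → T`, that is, `id_T ⊗_S φ` under the
identification `T ⊗_S (S ⊗ V) = T ⊗ V`. It maps `t ⊗ v` to `t • (f ⊗ id)(φ(1 ⊗ v))`. -/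
noncomputable def baseChange (f : VertexAlgHom R S T) (φ : VertexAlgHom S (S ⊗[R] V) (S ⊗[R] W)) :
    VertexAlgHom T (T ⊗[R] V) (T ⊗[R] W) :=
  liftBaseChange T
    ((tensorMap f (VertexAlgHom.id R W)).comp ((φ.restrictScalars R).comp (inr R S V)))

theorem baseChange_tmul (f : VertexAlgHom R S T) (φ : VertexAlgHom S (S ⊗[R] V) (S ⊗[R] W))
    (t : T) (v : V) : (baseChange f φ).toLinearMap (t ⊗ₜ v) =
      t • (tensorMap f (VertexAlgHom.id R W)).toLinearMap (φ.toLinearMap (1 ⊗ₜ v)) :=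
  LinearMap.liftBaseChange_tmul ..

theorem tensorMap_smul (f : VertexAlgHom R S T) (g : VertexAlgHom R V W) (s : S) (x : S ⊗[R] V) :
    (tensorMap f g).toLinearMap (s • x) = f.toLinearMap s • (tensorMap f g).toLinearMap x := by
  change TensorProduct.map f.toLinearMap g.toLinearMap _ =
    _ • TensorProduct.map f.toLinearMap g.toLinearMap _
  induction x with
  | zero => simp
  | add x y hx hy => simp [hx, hy]
  | tmul t v => simp [TensorProduct.smul_tmul', map_mul]

theorem baseChange_tensorMap (f : VertexAlgHom R S T)
    (φ : VertexAlgHom S (S ⊗[R] V) (S ⊗[R] W)) (x : S ⊗[R] V) :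
    (baseChange f φ).toLinearMap ((tensorMap f (VertexAlgHom.id R V)).toLinearMap x) =
      (tensorMap f (VertexAlgHom.id R W)).toLinearMap (φ.toLinearMap x) := by
  induction x with
  | zero => simp
  | add x y hx hy => simp [hx, hy]
  | tmul s v =>
    have h : (tensorMap f (VertexAlgHom.id R V)).toLinearMap (s ⊗ₜ v) =
      f.toLinearMap s ⊗ₜ v := rfl
    have h2 : s ⊗ₜ[R] v = s • ((1 : S) ⊗ₜ[R] v) := by simp [TensorProduct.smul_tmul']
    rw [h, baseChange_tmul, h2, map_smul, tensorMap_smul]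

theorem ext_tmul {f g : VertexAlgHom S (S ⊗[R] V) (S ⊗[R] W)}
    (h : ∀ v : V, f.toLinearMap (1 ⊗ₜ v) = g.toLinearMap (1 ⊗ₜ v)) : f = g := by
  refine VertexAlgHom.ext fun x => ?_
  induction x with
  | zero => simp
  | add x y hx hy => simp [hx, hy]
  | tmul s v =>
    have h2 : s ⊗ₜ[R] v = s • ((1 : S) ⊗ₜ[R] v) := by simp [TensorProduct.smul_tmul']
    rw [h2, map_smul, map_smul, h]

theorem baseChange_comp (f : VertexAlgHom R S T) (ψ : VertexAlgHom S (S ⊗[R] V) (S ⊗[R] W))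
    (φ : VertexAlgHom S (S ⊗[R] U) (S ⊗[R] V)) :
    baseChange f (ψ.comp φ) = (baseChange f ψ).comp (baseChange f φ) := by
  refine ext_tmul fun v => ?_
  change _ = (baseChange f ψ).toLinearMap ((baseChange f φ).toLinearMap _)
  rw [baseChange_tmul, baseChange_tmul, one_smul, one_smul, baseChange_tensorMap]
  rfl

theorem baseChange_id (f : VertexAlgHom R S T) :
    baseChange f (VertexAlgHom.id S (S ⊗[R] V)) = VertexAlgHom.id T (T ⊗[R] V) := by
  refine ext_tmul fun v => ?_
  rw [baseChange_tmul, one_smul]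
  change f.toLinearMap 1 ⊗ₜ v = 1 ⊗ₜ v
  rw [map_one]

theorem baseChange_id_left (φ : VertexAlgHom S (S ⊗[R] V) (S ⊗[R] W)) :
    baseChange (VertexAlgHom.id R S) φ = φ := by
  refine ext_tmul fun v => ?_
  rw [baseChange_tmul, one_smul]
  change TensorProduct.map LinearMap.id LinearMap.id _ = _
  rw [TensorProduct.map_id, LinearMap.id_apply]

theorem baseChange_comp_left (f : VertexAlgHom R S S') (g : VertexAlgHom R S' T)
    (φ : VertexAlgHom S (S ⊗[R] V) (S ⊗[R] W)) :
    baseChange (g.comp f) φ = baseChange g (baseChange f φ) := by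
  refine ext_tmul fun v => ?_
  rw [baseChange_tmul, baseChange_tmul, baseChange_tmul, one_smul, one_smul, one_smul]
  change TensorProduct.map (g.toLinearMap ∘ₗ f.toLinearMap) (LinearMap.id ∘ₗ LinearMap.id) _ = _
  rw [TensorProduct.map_comp]
  rfl

end VertexAlgHom

namespace VertexAlgEquiv

variable {R S T V W U : Type*} [CommRing R] [CommVertexRing R]
  [CommRing S] [CommVertexRing S] [Algebra R S] [VertexAlgebra R S]
  [CommRing T] [CommVertexRing T] [Algebra R T] [VertexAlgebra R T]
  [AddCommGroup V] [VertexRing V] [Module R V] [VertexAlgebra R V]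
  [AddCommGroup W] [VertexRing W] [Module R W] [VertexAlgebra R W]

/-- The base change of an isomorphism along `f : S → T`. -/
noncomputable def baseChange (f : VertexAlgHom R S T)
    (φ : VertexAlgEquiv S (S ⊗[R] V) (S ⊗[R] W)) : VertexAlgEquiv T (T ⊗[R] V) (T ⊗[R] W) :=
  ofInverse (VertexAlgHom.baseChange f φ.toHom) (VertexAlgHom.baseChange f φ.symm.toHom)
    (by rw [← VertexAlgHom.baseChange_comp, symm_toHom_comp_toHom, VertexAlgHom.baseChange_id])
    (by rw [← VertexAlgHom.baseChange_comp, toHom_comp_symm_toHom, VertexAlgHom.baseChange_id])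

theorem toHom_baseChange (f : VertexAlgHom R S T) (φ : VertexAlgEquiv S (S ⊗[R] V) (S ⊗[R] W)) :
    (VertexAlgEquiv.baseChange f φ).toHom = VertexAlgHom.baseChange f φ.toHom := rfl

theorem baseChange_symm_trans {T' : Type*} [CommRing T'] [CommVertexRing T'] [Algebra R T']
    [VertexAlgebra R T'] (f₀ f₁ : VertexAlgHom R S T) (g : VertexAlgHom R T T')
    (θ : VertexAlgEquiv S (S ⊗[R] W) (S ⊗[R] V)) :
    VertexAlgEquiv.baseChange g
        ((VertexAlgEquiv.baseChange f₁ θ).symm.trans (VertexAlgEquiv.baseChange f₀ θ)) =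
      (VertexAlgEquiv.baseChange (g.comp f₁) θ).symm.trans
        (VertexAlgEquiv.baseChange (g.comp f₀) θ) := by
  apply toHom_injective
  have h : ((VertexAlgEquiv.baseChange f₁ θ).symm.trans (VertexAlgEquiv.baseChange f₀ θ)).toHom =
      (VertexAlgHom.baseChange f₀ θ.toHom).comp (VertexAlgHom.baseChange f₁ θ.symm.toHom) := rfl
  have h' : ((VertexAlgEquiv.baseChange (g.comp f₁) θ).symm.trans
      (VertexAlgEquiv.baseChange (g.comp f₀) θ)).toHom =
      (VertexAlgHom.baseChange (g.comp f₀) θ.toHom).comp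
        (VertexAlgHom.baseChange (g.comp f₁) θ.symm.toHom) := rfl
  rw [toHom_baseChange, h, h', VertexAlgHom.baseChange_comp, VertexAlgHom.baseChange_comp_left,
    VertexAlgHom.baseChange_comp_left]

end VertexAlgEquiv

/-- The category `R-cva` of commutative `R`-vertex algebras. -/
structure CommVertexAlgCat.{u, r} (R : Type r) [CommRing R] [CommVertexRing R] where
  of ::
  carrier : Type u
  [commRing : CommRing carrier]
  [commVertexRing : CommVertexRing carrier]
  [algebra : Algebra R carrier]
  [vertexAlgebra : VertexAlgebra R carrier]

attribute [instance] CommVertexAlgCat.commRing CommVertexAlgCat.commVertexRing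
  CommVertexAlgCat.algebra CommVertexAlgCat.vertexAlgebra

namespace CommVertexAlgCat

variable {R : Type*} [CommRing R] [CommVertexRing R]

instance instCategory : CategoryTheory.Category (CommVertexAlgCat R) where
  Hom A B := VertexAlgHom R A.carrier B.carrier
  id A := VertexAlgHom.id R A.carrier
  comp f g := g.comp f

end CommVertexAlgCat

namespace VertexDescent

section Cohomology

universe u r w

variable (R : Type r) [CommRing R] [CommVertexRing R]
  (S : Type u) [CommRing S] [CommVertexRing S] [Algebra R S] [VertexAlgebra R S]

open VertexAlgHom

/-- The coface maps `d⁰(a) = 1 ⊗ a` and `d¹(a) = a ⊗ 1` from `S` to `S ⊗ S`. -/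
noncomputable def face₁ (i : Fin 2) :
    CommVertexAlgCat.of (R := R) S ⟶ CommVertexAlgCat.of (S ⊗[R] S) :=
  match i with
  | 0 => inr R S S
  | 1 => inl R S S

/-- The coface maps from `S ⊗ S` to `S ⊗ S ⊗ S`: `d⁰(a ⊗ b) = 1 ⊗ a ⊗ b`, `d¹(a ⊗ b) = a ⊗ 1 ⊗ b` and
`d²(a ⊗ b) = a ⊗ b ⊗ 1`. -/
noncomputable def face₂ (i : Fin 3) :
    CommVertexAlgCat.of (R := R) (S ⊗[R] S) ⟶ CommVertexAlgCat.of (S ⊗[R] (S ⊗[R] S)) :=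
  match i with
  | 0 => inr R S (S ⊗[R] S)
  | 1 => tensorMap (VertexAlgHom.id R S) (inr R S S)
  | 2 => tensorMap (VertexAlgHom.id R S) (inl R S S)

variable (G : CategoryTheory.Functor (CommVertexAlgCat.{u} R) GrpCat.{w})

/-- The set `Z¹(S/R, G)` of `φ ∈ G(S ⊗ S)` with `d¹φ = d⁰φ · d²φ`. -/
def Cocycle : Type w :=
  {φ : G.obj (.of (S ⊗[R] S)) //
    (G.map (face₂ R S 1)).hom φ = (G.map (face₂ R S 0)).hom φ * (G.map (face₂ R S 2)).hom φ}

/-- The trivial cocycle. -/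
noncomputable instance Cocycle.instOne : One (Cocycle R S G) := ⟨⟨1, by simp⟩⟩

/-- Cohomologous cocycles: `ψ = d⁰g · φ · (d¹g)⁻¹` for some `g ∈ G(S)`. -/
def cocycleSetoid : Setoid (Cocycle R S G) where
  r φ ψ := ∃ g : G.obj (.of S),
    ψ.val = (G.map (face₁ R S 0)).hom g * φ.val * ((G.map (face₁ R S 1)).hom g)⁻¹
  iseqv :=
    { refl := fun φ => ⟨1, by simp⟩
      symm := by
        rintro φ ψ ⟨g, hg⟩
        exact ⟨g⁻¹, by simp [hg, mul_assoc]⟩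
      trans := by
        rintro φ ψ χ ⟨g, hg⟩ ⟨h, hh⟩
        exact ⟨h * g, by simp [hg, hh, mul_assoc]⟩ }

/-- The non-abelian cohomology set `H¹(S/R, G)`. -/
def H1 : Type w := Quotient (cocycleSetoid R S G)

/-- The class of a cocycle. -/
def H1.mk (φ : Cocycle R S G) : H1 R S G := Quotient.mk (cocycleSetoid R S G) φ

/-- The distinguished element: the class of the trivial cocycle. -/
noncomputable instance H1.instOne : One (H1 R S G) := ⟨H1.mk R S G 1⟩

end Cohomology

section Forms

universe u r v

variable (R : Type r) [CommRing R] [CommVertexRing R]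
  (S : Type u) [CommRing S] [CommVertexRing S] [Algebra R S] [VertexAlgebra R S]
  (V : Type v) [AddCommGroup V] [VertexRing V] [Module R V] [VertexAlgebra R V]

/-- The group functor `Aut(V)`, with `Aut(V)(A) = Aut_A(A ⊗ V)`. -/
noncomputable def autFunctor :
    CategoryTheory.Functor (CommVertexAlgCat.{u} R) GrpCat.{max u v} where
  obj A := GrpCat.of (VertexAlgEquiv A.carrier (A.carrier ⊗[R] V) (A.carrier ⊗[R] V))
  map {A B} f := GrpCat.ofHom
    { toFun := fun φ => VertexAlgEquiv.baseChange f φ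
      map_one' := VertexAlgEquiv.toHom_injective (VertexAlgHom.baseChange_id f)
      map_mul' := fun φ ψ =>
        VertexAlgEquiv.toHom_injective (VertexAlgHom.baseChange_comp f φ.toHom ψ.toHom) }
  map_id A := by
    refine GrpCat.hom_ext (MonoidHom.ext fun φ => ?_)
    exact VertexAlgEquiv.toHom_injective (VertexAlgHom.baseChange_id_left (VertexAlgEquiv.toHom φ))
  map_comp f g := by
    refine GrpCat.hom_ext (MonoidHom.ext fun φ => ?_)
    exact VertexAlgEquiv.toHom_injective
      (VertexAlgHom.baseChange_comp_left f g (VertexAlgEquiv.toHom φ))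

/-- An `S/R`-form of `V`: an `R`-vertex algebra that becomes isomorphic to `V` over `S`. -/
structure TwistedForm where
  carrier : Type v
  [addCommGroup : AddCommGroup carrier]
  [vertexRing : VertexRing carrier]
  [module : Module R carrier]
  [vertexAlgebra : VertexAlgebra R carrier]
  isForm : Nonempty (VertexAlgEquiv S (S ⊗[R] carrier) (S ⊗[R] V))

attribute [instance] TwistedForm.addCommGroup TwistedForm.vertexRing TwistedForm.module
  TwistedForm.vertexAlgebra

/-- `V` itself, as an `S/R`-form of `V`. -/
def TwistedForm.self : TwistedForm R S V where
  carrier := V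
  isForm := ⟨VertexAlgEquiv.refl S _⟩

/-- `R`-isomorphism of `S/R`-forms. -/
def twistedFormSetoid : Setoid (TwistedForm R S V) where
  r W W' := Nonempty (VertexAlgEquiv R W.carrier W'.carrier)
  iseqv :=
    { refl := fun _ => ⟨VertexAlgEquiv.refl R _⟩
      symm := fun ⟨f⟩ => ⟨f.symm⟩
      trans := fun ⟨f⟩ ⟨g⟩ => ⟨f.trans g⟩ }

/-- The `R`-isomorphism classes of `S/R`-forms of `V`. -/
def FormClasses : Type (max r (v + 1)) := Quotient (twistedFormSetoid R S V)

/-- The `R`-isomorphism class of an `S/R`-form. -/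
def FormClasses.mk (W : TwistedForm R S V) : FormClasses R S V :=
  Quotient.mk (twistedFormSetoid R S V) W

variable {R S V}

/-- The automorphism `d⁰θ ∘ (d¹θ)⁻¹` of `S ⊗ S ⊗ V` attached to a trivialization
`θ : S ⊗ W ≃ S ⊗ V`. -/
noncomputable def transitionAut {W : Type v} [AddCommGroup W] [VertexRing W] [Module R W]
    [VertexAlgebra R W] (θ : VertexAlgEquiv S (S ⊗[R] W) (S ⊗[R] V)) :
    VertexAlgEquiv (S ⊗[R] S) ((S ⊗[R] S) ⊗[R] V) ((S ⊗[R] S) ⊗[R] V) :=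
  (VertexAlgEquiv.baseChange (face₁ R S 1) θ).symm.trans
    (VertexAlgEquiv.baseChange (face₁ R S 0) θ)

theorem baseChange_transitionAut {W : Type v} [AddCommGroup W] [VertexRing W] [Module R W]
    [VertexAlgebra R W] (θ : VertexAlgEquiv S (S ⊗[R] W) (S ⊗[R] V)) :
    VertexAlgEquiv.baseChange (face₂ R S 1) (transitionAut θ) =
      VertexAlgEquiv.baseChange (face₂ R S 0) (transitionAut θ) *
        VertexAlgEquiv.baseChange (face₂ R S 2) (transitionAut θ) := by
  have h01 : VertexAlgHom.comp (face₂ R S 1) (face₁ R S 0) =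
    VertexAlgHom.comp (face₂ R S 0) (face₁ R S 0) := rfl
  have h11 : VertexAlgHom.comp (face₂ R S 1) (face₁ R S 1) =
    VertexAlgHom.comp (face₂ R S 2) (face₁ R S 1) := rfl
  have h02 : VertexAlgHom.comp (face₂ R S 2) (face₁ R S 0) =
    VertexAlgHom.comp (face₂ R S 0) (face₁ R S 1) := rfl
  have h : ∀ i : Fin 3, VertexAlgEquiv.baseChange (face₂ R S i) (transitionAut θ) = _ := fun i =>
    VertexAlgEquiv.baseChange_symm_trans (face₁ R S 0) (face₁ R S 1) (face₂ R S i) θ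
  rw [h, h, h, h01, h11, h02, VertexAlgEquiv.symm_trans_mul_symm_trans]

/-- The cocycle `d⁰θ ∘ (d¹θ)⁻¹` attached to a trivialization `θ : S ⊗ W ≃ S ⊗ V`. -/
noncomputable def transitionCocycle {W : Type v} [AddCommGroup W] [VertexRing W] [Module R W]
    [VertexAlgebra R W] (θ : VertexAlgEquiv S (S ⊗[R] W) (S ⊗[R] V)) :
    Cocycle R S (autFunctor R V) :=
  ⟨transitionAut θ, baseChange_transitionAut θ⟩

end Forms

end VertexDescent

/-! A cocycle `φ` is a descent datum on `S ⊗ V`: `x ↦ φ(d¹x)` is a coaction `S ⊗ V → S ⊗ (S ⊗ V)`,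
whose coassociativity is the cocycle identity and whose counit law is the triviality of `φ` along
the multiplication `S ⊗ S → S`. The locus `φ(d¹x) = d⁰x` is closed under all products, since both
sides are homomorphisms of vertex algebras, and by flatness `s ⊗ x ↦ s • x` identifies its base
change with `S ⊗ V`; this isomorphism has transition cocycle `φ`, which gives surjectivity. For
injectivity, forms whose trivializations have the same transition cocycle are related by an
isomorphism `ψ` over `S` with `d⁰ψ = d¹ψ`; exactness of the Amitsur sequence `M → S ⊗ M → S ⊗ S ⊗ M`
shows that `ψ` maps `1 ⊗ W` to `1 ⊗ W'`, and faithful flatness that the restriction is a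
homomorphism. -/

section FlatDescent

open TensorProduct

variable {R S M N P : Type*} [CommRing R] [CommRing S] [Algebra R S]
  [AddCommGroup M] [Module R M] [AddCommGroup N] [Module R N]
  [AddCommGroup P] [Module R P] [Module S P] [IsScalarTower R S P]

variable (R S P) in
/-- The action `S ⊗ P → P` of `S` on an `S`-module `P`, as an `S`-linear map. -/
noncomputable def actionMap : S ⊗[R] P →ₗ[S] P := LinearMap.id.liftBaseChange S

theorem actionMap_tmul (s : S) (p : P) : actionMap R S P (s ⊗ₜ p) = s • p :=
  LinearMap.liftBaseChange_tmul ..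

theorem actionMap_lTensor (f : N →ₗ[R] P) (y : S ⊗[R] N) :
    actionMap R S P (f.lTensor S y) = f.liftBaseChange S y := by
  induction y with
  | zero => simp only [map_zero]
  | add x y hx hy => simp only [map_add, hx, hy]
  | tmul s n => rw [LinearMap.lTensor_tmul, actionMap_tmul, LinearMap.liftBaseChange_tmul]

theorem liftBaseChange_lTensor (f : M →ₗ[R] N) (x : S ⊗[R] (S ⊗[R] M)) :
    (f.lTensor S).liftBaseChange S x = f.lTensor S (actionMap R S (S ⊗[R] M) x) := by
  induction x with
  | zero => simp only [map_zero]
  | add x y hx hy => simp only [map_add, hx, hy]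
  | tmul s x =>
    rw [LinearMap.liftBaseChange_tmul, actionMap_tmul]
    exact ((f.baseChange S).map_smul s x).symm

theorem liftBaseChange_mk_one (x : S ⊗[R] M) : (mk R S M 1).liftBaseChange S x = x := by
  induction x with
  | zero => simp only [map_zero]
  | add x y hx hy => simp only [map_add, hx, hy]
  | tmul s m => rw [LinearMap.liftBaseChange_tmul, mk_apply, smul_tmul', smul_eq_mul, mul_one]

theorem assoc_tmul_one_smul {T : Type*} [CommRing T] [Algebra R T] (s : S)
    (z : (S ⊗[R] T) ⊗[R] M) :
    TensorProduct.assoc R S T M ((s ⊗ₜ[R] (1 : T)) • z) = s • TensorProduct.assoc R S T M z := by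
  have hs : (s ⊗ₜ[R] (1 : T)) • z = s • z := algebraMap_smul (S ⊗[R] T) s z
  rw [hs]
  exact (AlgebraTensorModule.assoc R R S S T M).map_smul s z

/-- After tensoring with `S` the sequence is split by the action of the new factor on the next
one. -/
theorem exact_mk_one_lTensor_sub_mk_one [Module.FaithfullyFlat R S] :
    Function.Exact (mk R S M 1) ((mk R S M 1).lTensor S - mk R S (S ⊗[R] M) 1) := by
  rw [← Module.FaithfullyFlat.lTensor_exact_iff_exact R S]
  intro x
  constructor
  · intro hx
    rw [LinearMap.lTensor_sub, LinearMap.sub_apply, sub_eq_zero] at hx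
    have hx' := congrArg (actionMap R S (S ⊗[R] (S ⊗[R] M))) hx
    rw [actionMap_lTensor, actionMap_lTensor, liftBaseChange_lTensor, liftBaseChange_mk_one] at hx'
    exact ⟨_, hx'⟩
  · rintro ⟨y, rfl⟩
    rw [LinearMap.lTensor_sub, LinearMap.sub_apply, sub_eq_zero, ← LinearMap.lTensor_comp_apply,
      ← LinearMap.lTensor_comp_apply]
    rfl

theorem exists_one_tmul_eq [Module.FaithfullyFlat R S] {x : S ⊗[R] M}
    (hx : (mk R S M 1).lTensor S x = 1 ⊗ₜ x) : ∃ m : M, 1 ⊗ₜ m = x :=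
  (exact_mk_one_lTensor_sub_mk_one x).mp (sub_eq_zero.mpr hx)

/-- A descent datum on an `S`-module `P` relative to `R → S`, encoded as a coaction: a coalgebra
structure on `P` over the comonad `S ⊗[R] -`. -/
structure IsDescentCoaction (ρ : P →ₗ[S] S ⊗[R] P) : Prop where
  counit (p : P) : actionMap R S P (ρ p) = p
  coassoc (p : P) :
    (ρ.restrictScalars R).lTensor S (ρ p) = (TensorProduct.mk R S P 1).lTensor S (ρ p)

theorem map_liftBaseChange_eq_lTensor {ρ : P →ₗ[S] S ⊗[R] P} {ι : N →ₗ[R] P}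
    (hι : ∀ n, ρ (ι n) = 1 ⊗ₜ ι n) (y : S ⊗[R] N) : ρ (ι.liftBaseChange S y) = ι.lTensor S y := by
  induction y with
  | zero => simp only [map_zero]
  | add x y hx hy => simp only [map_add, hx, hy]
  | tmul s n =>
    rw [LinearMap.liftBaseChange_tmul, map_smul, hι, smul_tmul', smul_eq_mul, mul_one,
      LinearMap.lTensor_tmul]

theorem IsDescentCoaction.bijective_liftBaseChange [Module.Flat R S] {ρ : P →ₗ[S] S ⊗[R] P}
    (hρ : IsDescentCoaction ρ) {ι : N →ₗ[R] P} (hinj : Function.Injective ι)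
    (hex : Function.Exact ι (ρ.restrictScalars R - TensorProduct.mk R S P 1)) :
    Function.Bijective (ι.liftBaseChange S) := by
  have hι (n : N) : ρ (ι n) = 1 ⊗ₜ ι n := sub_eq_zero.mp (hex.apply_apply_eq_zero n)
  constructor
  · intro y y' h
    apply Module.Flat.lTensor_preserves_injective_linearMap (M := S) ι hinj
    rw [← map_liftBaseChange_eq_lTensor hι, h, map_liftBaseChange_eq_lTensor hι]
  · intro p
    have hker : (ρ.restrictScalars R - TensorProduct.mk R S P 1).lTensor S (ρ p) = 0 := by
      rw [LinearMap.lTensor_sub, LinearMap.sub_apply, hρ.coassoc, sub_self]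
    obtain ⟨y, hy⟩ := (Module.Flat.lTensor_exact S hex (ρ p)).mp hker
    exact ⟨y, by rw [← actionMap_lTensor, hy, hρ.counit]⟩

end FlatDescent

/-- A vertex subalgebra: a submodule that contains the vacuum and is closed under all products. -/
structure VertexSubalgebra (R V : Type*) [CommRing R] [AddCommGroup V] [VertexRing V]
    [Module R V] extends Submodule R V where
  vac_mem' : VertexRing.vac ∈ carrier
  nprod_mem' (n : ℤ) {u v : V} : u ∈ carrier → v ∈ carrier → VertexRing.nprod n u v ∈ carrier

namespace VertexSubalgebra

open VertexRing VertexAlgebra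

variable {R V : Type*} [CommRing R] [AddCommGroup V] [VertexRing V] [Module R V]

/-- The underlying type of a vertex subalgebra. It is a definition rather than an abbreviation
because instance search on `S ⊗[R] A` gets stuck on the coercion of a submodule when `V` is itself a
tensor product. -/
def Carrier (A : VertexSubalgebra R V) : Type _ := A.toSubmodule

instance instCoeSort : CoeSort (VertexSubalgebra R V) (Type _) := ⟨Carrier⟩

instance instAddCommGroup (A : VertexSubalgebra R V) : AddCommGroup A :=
  inferInstanceAs (AddCommGroup A.toSubmodule)

instance instModule (A : VertexSubalgebra R V) : Module R A :=
  inferInstanceAs (Module R A.toSubmodule)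

instance instVertexRing (A : VertexSubalgebra R V) : VertexRing A where
  nprod n := AddMonoidHom.mk' (fun u => AddMonoidHom.mk'
      (fun v => ⟨nprod n u.1 v.1, A.nprod_mem' n u.2 v.2⟩)
      fun v w => Subtype.ext (map_add (nprod n u.1) v.1 w.1))
    fun u v => AddMonoidHom.ext fun w =>
      Subtype.ext (DFunLike.congr_fun (map_add (nprod n) u.1 v.1) w.1)
  vac := ⟨vac, A.vac_mem'⟩
  regularity u v := (regularity u.1 v.1).imp fun _ hN n hn => Subtype.ext (hN n hn)
  creation_of_nonneg v n hn := Subtype.ext (creation_of_nonneg v.1 n hn)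
  creation_neg_one v := Subtype.ext (creation_neg_one v.1)
  jacobi u v w l m n := by
    let i : A →+ V := A.toSubmodule.subtype.toAddMonoidHom
    have hi : Function.Injective i := Subtype.val_injective
    apply hi
    rw [AddMonoidHom.map_finsum_of_injective i hi, AddMonoidHom.map_finsum_of_injective i hi]
    simp only [map_zsmul, map_sub]
    exact jacobi u.1 v.1 w.1 l m n

variable [CommVertexRing R]

instance instVertexAlgebra [VertexAlgebra R V] (A : VertexSubalgebra R V) : VertexAlgebra R A where
  nprod_smul_vac r s n := Subtype.ext (nprod_smul_vac (V := V) r s n)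
  smul_vac_mem_center r u w m n := Subtype.ext (smul_vac_mem_center (V := V) r u.1 w.1 m n)
  smul_eq_nprod r v := Subtype.ext (smul_eq_nprod r v.1)

/-- The inclusion of a vertex subalgebra. -/
def subtype (A : VertexSubalgebra R V) : VertexAlgHom R A V where
  toLinearMap := A.toSubmodule.subtype
  map_vac' := rfl
  map_nprod' _ _ _ := rfl

end VertexSubalgebra

instance VertexAlgebra.instSelf (R : Type*) [CommRing R] [CommVertexRing R] :
    VertexAlgebra R R where
  nprod_smul_vac r s n := by
    simp only [← CommVertexRing.one_eq_vac, smul_eq_mul, mul_one]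
  smul_vac_mem_center r := CommVertexRing.mem_center _
  smul_eq_nprod r s := by
    rw [← CommVertexRing.one_eq_vac, smul_eq_mul, smul_eq_mul, mul_one, CommVertexRing.mul_eq_nprod]

namespace VertexAlgHom

open VertexRing

section

variable {R U V W : Type*} [CommRing R] [CommVertexRing R]
  [AddCommGroup U] [VertexRing U] [Module R U]
  [AddCommGroup V] [VertexRing V] [Module R V] [AddCommGroup W] [VertexRing W] [Module R W]

theorem comp_apply (g : VertexAlgHom R V W) (f : VertexAlgHom R U V) (u : U) :
    (g.comp f).toLinearMap u = g.toLinearMap (f.toLinearMap u) := rfl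

theorem id_apply (v : V) : (VertexAlgHom.id R V).toLinearMap v = v := rfl

/-- The vertex subalgebra on which two homomorphisms agree. -/
def eqLocus (f g : VertexAlgHom R V W) : VertexSubalgebra R V where
  toSubmodule := LinearMap.eqLocus f.toLinearMap g.toLinearMap
  vac_mem' := f.map_vac.trans g.map_vac.symm
  nprod_mem' n u v (hu : _ = _) (hv : _ = _) := by
    change f.toLinearMap _ = g.toLinearMap _
    rw [map_nprod, map_nprod, hu, hv]

theorem exists_comp_eq_of_injective {j : VertexAlgHom R V W} (hj : Function.Injective j.toLinearMap)
    (h : VertexAlgHom R U W) (hrange : ∀ u, ∃ v, j.toLinearMap v = h.toLinearMap u) :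
    ∃ f : VertexAlgHom R U V, j.comp f = h := by
  choose f hf using hrange
  exact ⟨{
    toFun := f
    map_add' := fun u v => hj (by rw [map_add, hf, hf, hf, map_add])
    map_smul' := fun r u => hj (by rw [hf, map_smul, map_smul, hf, RingHom.id_apply])
    map_vac' := hj ((hf _).trans (h.map_vac.trans j.map_vac.symm))
    map_nprod' := fun n u v => hj (by
      rw [map_nprod, hf, hf, hf, map_nprod]) }, VertexAlgHom.ext hf⟩

end

variable {R S T U V W : Type*} [CommRing R] [CommVertexRing R]
  [CommRing S] [CommVertexRing S] [Algebra R S] [VertexAlgebra R S]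
  [CommRing T] [CommVertexRing T] [Algebra R T] [VertexAlgebra R T]
  [AddCommGroup U] [VertexRing U] [Module R U] [VertexAlgebra R U]
  [AddCommGroup V] [VertexRing V] [Module R V] [VertexAlgebra R V]
  [AddCommGroup W] [VertexRing W] [Module R W] [VertexAlgebra R W]

variable (R S) in
/-- The multiplication `S ⊗ S → S`. -/
noncomputable def mulHom : VertexAlgHom R (S ⊗[R] S) S :=
  (liftBaseChange S (VertexAlgHom.id R S)).restrictScalars R

theorem mulHom_tmul (s t : S) : (mulHom R S).toLinearMap (s ⊗ₜ t) = s * t :=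
  LinearMap.liftBaseChange_tmul ..

theorem mulHom_comp_inl : (mulHom R S).comp (inl R S S) = VertexAlgHom.id R S :=
  VertexAlgHom.ext fun s => (mulHom_tmul s 1).trans (mul_one s)

variable (V) in
/-- The map `f ⊗ V` from `S ⊗ V` to `T ⊗ V` induced by `f : S → T`. -/
noncomputable abbrev rTensor (f : VertexAlgHom R S T) : VertexAlgHom R (S ⊗[R] V) (T ⊗[R] V) :=
  tensorMap f (VertexAlgHom.id R V)

theorem rTensor_rTensor {T' : Type*} [CommRing T'] [CommVertexRing T'] [Algebra R T']
    [VertexAlgebra R T'] (g : VertexAlgHom R T T') (f : VertexAlgHom R S T) (x : S ⊗[R] V) :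
    (rTensor V g).toLinearMap ((rTensor V f).toLinearMap x) =
      (rTensor V (g.comp f)).toLinearMap x :=
  LinearMap.congr_fun (LinearMap.rTensor_comp V g.toLinearMap f.toLinearMap).symm x

variable (S) in
/-- The map `S ⊗ f` from `S ⊗ V` to `S ⊗ W` induced by `f : V → W`. -/
noncomputable def extendScalars (f : VertexAlgHom R V W) :
    VertexAlgHom S (S ⊗[R] V) (S ⊗[R] W) where
  toLinearMap := f.toLinearMap.baseChange S
  map_vac' := (tensorMap (VertexAlgHom.id R S) f).map_vac'
  map_nprod' := (tensorMap (VertexAlgHom.id R S) f).map_nprod'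

theorem extendScalars_tmul (f : VertexAlgHom R V W) (s : S) (v : V) :
    (extendScalars S f).toLinearMap (s ⊗ₜ v) = s ⊗ₜ f.toLinearMap v := rfl

theorem extendScalars_id : extendScalars S (VertexAlgHom.id R V) = VertexAlgHom.id S (S ⊗[R] V) :=
  ext_tmul fun _ => rfl

theorem extendScalars_comp (g : VertexAlgHom R V W) (f : VertexAlgHom R U V) :
    extendScalars S (g.comp f) = (extendScalars S g).comp (extendScalars S f) :=
  ext_tmul fun _ => rfl

theorem extendScalars_injective [Module.FaithfullyFlat R S] :
    Function.Injective (extendScalars S : VertexAlgHom R V W → _) := fun _ _ h =>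
  VertexAlgHom.ext fun v => Module.FaithfullyFlat.tensorProduct_mk_injective (A := R) (B := S) W
    (LinearMap.congr_fun (congrArg toLinearMap h) (1 ⊗ₜ[R] v))

theorem baseChange_extendScalars (g : VertexAlgHom R S T) (f : VertexAlgHom R V W) :
    baseChange g (extendScalars S f) = extendScalars T f :=
  ext_tmul fun v => by
    rw [baseChange_tmul, one_smul, extendScalars_tmul, extendScalars_tmul]
    exact congrArg (· ⊗ₜ[R] f.toLinearMap v) g.map_one

end VertexAlgHom

namespace VertexAlgEquiv

section

variable {R U V W X : Type*} [CommRing R] [CommVertexRing R]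
  [AddCommGroup U] [VertexRing U] [Module R U] [AddCommGroup V] [VertexRing V] [Module R V]
  [AddCommGroup W] [VertexRing W] [Module R W] [AddCommGroup X] [VertexRing X] [Module R X]

/-- A bijective homomorphism, as an isomorphism. -/
noncomputable def ofBijective (f : VertexAlgHom R V W) (hf : Function.Bijective f.toLinearMap) :
    VertexAlgEquiv R V W where
  toLinearEquiv := LinearEquiv.ofBijective f.toLinearMap hf
  map_vac' := f.map_vac'
  map_nprod' := f.map_nprod'

theorem trans_symm_trans (e : VertexAlgEquiv R U V) (f : VertexAlgEquiv R U W) :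
    e.trans (e.symm.trans f) = f :=
  VertexAlgEquiv.ext fun u => congrArg f.toLinearEquiv (e.toLinearEquiv.symm_apply_apply u)

theorem symm_trans_trans (e : VertexAlgEquiv R U V) (f : VertexAlgEquiv R V W) :
    e.symm.trans (e.trans f) = f :=
  VertexAlgEquiv.ext fun v => congrArg f.toLinearEquiv (e.toLinearEquiv.apply_symm_apply v)

theorem trans_symm_trans_trans (e : VertexAlgEquiv R X U) (f : VertexAlgEquiv R U V)
    (g : VertexAlgEquiv R U W) : (e.trans f).symm.trans (e.trans g) = f.symm.trans g :=
  VertexAlgEquiv.ext fun _ => congrArg g.toLinearEquiv (e.toLinearEquiv.apply_symm_apply _)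

theorem trans_symm_eq_trans_symm {f : VertexAlgEquiv R U V} {g : VertexAlgEquiv R U W}
    {f' : VertexAlgEquiv R X V} {g' : VertexAlgEquiv R X W}
    (h : f.symm.trans g = f'.symm.trans g') : f.trans f'.symm = g.trans g'.symm := by
  rw [← trans_symm_trans f g, h]
  exact VertexAlgEquiv.ext fun _ => (g'.toLinearEquiv.symm_apply_apply _).symm

end

variable {R S T U V W : Type*} [CommRing R] [CommVertexRing R]
  [CommRing S] [CommVertexRing S] [Algebra R S] [VertexAlgebra R S]
  [CommRing T] [CommVertexRing T] [Algebra R T] [VertexAlgebra R T]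
  [AddCommGroup U] [VertexRing U] [Module R U] [VertexAlgebra R U]
  [AddCommGroup V] [VertexRing V] [Module R V] [VertexAlgebra R V]
  [AddCommGroup W] [VertexRing W] [Module R W] [VertexAlgebra R W]

theorem baseChange_trans (f : VertexAlgHom R S T) (φ : VertexAlgEquiv S (S ⊗[R] U) (S ⊗[R] V))
    (ψ : VertexAlgEquiv S (S ⊗[R] V) (S ⊗[R] W)) :
    VertexAlgEquiv.baseChange f (φ.trans ψ) =
      (VertexAlgEquiv.baseChange f φ).trans (VertexAlgEquiv.baseChange f ψ) :=
  toHom_injective (VertexAlgHom.baseChange_comp f ψ.toHom φ.toHom)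

variable (S) in
/-- The isomorphism `S ⊗ f` from `S ⊗ V` to `S ⊗ W` induced by `f : V ≃ W`. -/
noncomputable def extendScalars (f : VertexAlgEquiv R V W) :
    VertexAlgEquiv S (S ⊗[R] V) (S ⊗[R] W) :=
  ofInverse (VertexAlgHom.extendScalars S f.toHom) (VertexAlgHom.extendScalars S f.symm.toHom)
    (by rw [← VertexAlgHom.extendScalars_comp, symm_toHom_comp_toHom,
      VertexAlgHom.extendScalars_id])
    (by rw [← VertexAlgHom.extendScalars_comp, toHom_comp_symm_toHom,
      VertexAlgHom.extendScalars_id])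

theorem baseChange_extendScalars (g : VertexAlgHom R S T) (f : VertexAlgEquiv R V W) :
    VertexAlgEquiv.baseChange g (extendScalars S f) = extendScalars T f :=
  toHom_injective (VertexAlgHom.baseChange_extendScalars g f.toHom)

end VertexAlgEquiv

namespace VertexDescent

open VertexAlgHom

section Associator

variable {R S T T' V W : Type*} [CommRing R] [CommVertexRing R]
  [CommRing S] [CommVertexRing S] [Algebra R S] [VertexAlgebra R S]
  [CommRing T] [CommVertexRing T] [Algebra R T] [VertexAlgebra R T]
  [CommRing T'] [CommVertexRing T'] [Algebra R T'] [VertexAlgebra R T']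
  [AddCommGroup V] [VertexRing V] [Module R V] [VertexAlgebra R V]
  [AddCommGroup W] [VertexRing W] [Module R W] [VertexAlgebra R W]

theorem assoc_rTensor_inr (x : T ⊗[R] V) :
    TensorProduct.assoc R S T V ((rTensor V (inr R S T)).toLinearMap x) = 1 ⊗ₜ x := by
  induction x with
  | zero => simp only [map_zero, TensorProduct.tmul_zero]
  | add x y hx hy => simp only [map_add, TensorProduct.tmul_add, hx, hy]
  | tmul t v => rfl

theorem assoc_rTensor_inl (x : S ⊗[R] V) :
    TensorProduct.assoc R S T V ((rTensor V (inl R S T)).toLinearMap x) =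
      (TensorProduct.mk R T V 1).lTensor S x := by
  induction x with
  | zero => simp only [map_zero]
  | add x y hx hy => simp only [map_add, hx, hy]
  | tmul s v => rfl

theorem assoc_rTensor_tensorMap (f : VertexAlgHom R T T') (z : (S ⊗[R] T) ⊗[R] V) :
    TensorProduct.assoc R S T' V ((rTensor V (tensorMap (VertexAlgHom.id R S) f)).toLinearMap z) =
      (rTensor V f).toLinearMap.lTensor S (TensorProduct.assoc R S T V z) :=
  LinearMap.congr_fun
    (f := (TensorProduct.assoc R S T' V).toLinearMap ∘ₗ
      (rTensor V (tensorMap (VertexAlgHom.id R S) f)).toLinearMap)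
    (g := (rTensor V f).toLinearMap.lTensor S ∘ₗ (TensorProduct.assoc R S T V).toLinearMap)
    (TensorProduct.ext_threefold fun _ _ _ => rfl) z

theorem assoc_tmul_smul_rTensor_inr (s : S) (t : T) (x : T ⊗[R] V) :
    TensorProduct.assoc R S T V ((s ⊗ₜ[R] t) • (rTensor V (inr R S T)).toLinearMap x) =
      s ⊗ₜ (t • x) := by
  have hst : s ⊗ₜ[R] t = (s ⊗ₜ[R] (1 : T)) * (inr R S T).toLinearMap t := by
    change _ = (s ⊗ₜ[R] (1 : T)) * ((1 : S) ⊗ₜ[R] t)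
    rw [Algebra.TensorProduct.tmul_mul_tmul, mul_one, one_mul]
  rw [hst, mul_smul, ← tensorMap_smul, assoc_tmul_one_smul, assoc_rTensor_inr,
    TensorProduct.smul_tmul', smul_eq_mul, mul_one]

theorem assoc_baseChange_inr (φ : VertexAlgHom T (T ⊗[R] V) (T ⊗[R] W)) (z : (S ⊗[R] T) ⊗[R] V) :
    TensorProduct.assoc R S T W ((baseChange (inr R S T) φ).toLinearMap z) =
      (φ.restrictScalars R).toLinearMap.lTensor S (TensorProduct.assoc R S T V z) := by
  refine LinearMap.congr_fun
    (f := (TensorProduct.assoc R S T W).toLinearMap ∘ₗ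
      ((baseChange (inr R S T) φ).restrictScalars R).toLinearMap)
    (g := (φ.restrictScalars R).toLinearMap.lTensor S ∘ₗ (TensorProduct.assoc R S T V).toLinearMap)
    (TensorProduct.ext_threefold fun s t v => ?_) z
  change TensorProduct.assoc R S T W ((baseChange (inr R S T) φ).toLinearMap ((s ⊗ₜ t) ⊗ₜ v)) =
    s ⊗ₜ φ.toLinearMap (t ⊗ₜ v)
  rw [baseChange_tmul, assoc_tmul_smul_rTensor_inr, ← map_smul, TensorProduct.smul_tmul',
    smul_eq_mul, mul_one]

theorem actionMap_assoc (z : (S ⊗[R] S) ⊗[R] V) :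
    actionMap R S (S ⊗[R] V) (TensorProduct.assoc R S S V z) =
      (rTensor V (mulHom R S)).toLinearMap z := by
  refine LinearMap.congr_fun
    (f := (actionMap R S (S ⊗[R] V)).restrictScalars R ∘ₗ
      (TensorProduct.assoc R S S V).toLinearMap)
    (g := (rTensor V (mulHom R S)).toLinearMap)
    (TensorProduct.ext_threefold fun s t v => ?_) z
  change actionMap R S (S ⊗[R] V) (s ⊗ₜ (t ⊗ₜ v)) = (mulHom R S).toLinearMap (s ⊗ₜ t) ⊗ₜ v
  rw [actionMap_tmul, mulHom_tmul, TensorProduct.smul_tmul', smul_eq_mul]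

theorem exists_extendScalars_eq [Module.FaithfullyFlat R S]
    (ψ : VertexAlgHom S (S ⊗[R] V) (S ⊗[R] W))
    (hψ : baseChange (inl R S S) ψ = baseChange (inr R S S) ψ) :
    ∃ f : VertexAlgHom R V W, extendScalars S f = ψ := by
  have hrange (v : V) : ∃ w : W, 1 ⊗ₜ w = ψ.toLinearMap (1 ⊗ₜ v) := by
    apply exists_one_tmul_eq
    have hfaces : (rTensor W (inl R S S)).toLinearMap (ψ.toLinearMap (1 ⊗ₜ v)) =
        (rTensor W (inr R S S)).toLinearMap (ψ.toLinearMap (1 ⊗ₜ v)) := by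
      rw [← baseChange_tensorMap, ← baseChange_tensorMap, hψ]
      rfl
    rw [← assoc_rTensor_inl, hfaces, assoc_rTensor_inr]
  obtain ⟨f, hf⟩ := exists_comp_eq_of_injective (j := inr R S W)
    (Module.FaithfullyFlat.tensorProduct_mk_injective W)
    ((ψ.restrictScalars R).comp (inr R S V)) hrange
  exact ⟨f, ext_tmul fun v => LinearMap.congr_fun (congrArg toLinearMap hf) v⟩

theorem nonempty_equiv_of_baseChange_eq [Module.FaithfullyFlat R S]
    (ψ : VertexAlgEquiv S (S ⊗[R] V) (S ⊗[R] W))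
    (hψ : VertexAlgEquiv.baseChange (inl R S S) ψ = VertexAlgEquiv.baseChange (inr R S S) ψ) :
    Nonempty (VertexAlgEquiv R V W) := by
  obtain ⟨f, hf⟩ := exists_extendScalars_eq ψ.toHom (congrArg VertexAlgEquiv.toHom hψ)
  obtain ⟨g, hg⟩ := exists_extendScalars_eq ψ.symm.toHom
    (congrArg (fun χ => χ.symm.toHom) hψ)
  refine ⟨VertexAlgEquiv.ofInverse f g (extendScalars_injective (S := S) ?_)
    (extendScalars_injective (S := S) ?_)⟩
  · rw [extendScalars_comp, hf, hg, ψ.symm_toHom_comp_toHom, extendScalars_id]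
  · rw [extendScalars_comp, hf, hg, ψ.toHom_comp_symm_toHom, extendScalars_id]

end Associator

section Cocycles

universe u r w

variable {R : Type r} [CommRing R] [CommVertexRing R]
  {S : Type u} [CommRing S] [CommVertexRing S] [Algebra R S] [VertexAlgebra R S]
  {G : CategoryTheory.Functor (CommVertexAlgCat.{u} R) GrpCat.{w}}

open CategoryTheory

variable (R S) in
/-- The multiplication `S ⊗ S → S`, as the codegeneracy of the Amitsur complex. -/
noncomputable def codegeneracy :
    CommVertexAlgCat.of (R := R) (S ⊗[R] S) ⟶ CommVertexAlgCat.of S := mulHom R S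

variable (R S) in
/-- The multiplication `S ⊗ S ⊗ S → S`, as the iterated codegeneracy of the Amitsur complex. -/
noncomputable def iteratedCodegeneracy :
    CommVertexAlgCat.of (R := R) (S ⊗[R] (S ⊗[R] S)) ⟶ CommVertexAlgCat.of S :=
  (mulHom R S).comp (tensorMap (VertexAlgHom.id R S) (mulHom R S))

theorem iteratedCodegeneracy_tmul (a b c : S) :
    (iteratedCodegeneracy R S).toLinearMap (a ⊗ₜ (b ⊗ₜ c)) = a * (b * c) := by
  change (mulHom R S).toLinearMap (a ⊗ₜ (mulHom R S).toLinearMap (b ⊗ₜ c)) = _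
  rw [mulHom_tmul, mulHom_tmul]

theorem face₂_comp_iteratedCodegeneracy (i : Fin 3) :
    face₂ R S i ≫ iteratedCodegeneracy R S = codegeneracy R S := by
  refine toLinearMap_injective (TensorProduct.ext' fun a b => ?_)
  refine Eq.trans ?_ (mulHom_tmul a b).symm
  match i with
  | 0 => exact (iteratedCodegeneracy_tmul 1 a b).trans (one_mul _)
  | 1 => exact (iteratedCodegeneracy_tmul a 1 b).trans (by rw [one_mul])
  | 2 => exact (iteratedCodegeneracy_tmul a b 1).trans (by rw [mul_one])

theorem Cocycle.map_codegeneracy (φ : Cocycle R S G) :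
    (G.map (codegeneracy R S)).hom φ.val = 1 := by
  have h := congrArg (G.map (iteratedCodegeneracy R S)).hom φ.property
  have hface (i : Fin 3) :
      (G.map (iteratedCodegeneracy R S)).hom ((G.map (face₂ R S i)).hom φ.val) =
        (G.map (codegeneracy R S)).hom φ.val := by
    rw [← face₂_comp_iteratedCodegeneracy i, G.map_comp]
    rfl
  rw [_root_.map_mul, hface, hface, hface] at h
  exact left_eq_mul.mp h

end Cocycles

section Descent

universe r u v

variable {R : Type r} [CommRing R] [CommVertexRing R]
  {S : Type u} [CommRing S] [CommVertexRing S] [Algebra R S] [VertexAlgebra R S]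
  {V : Type v} [AddCommGroup V] [VertexRing V] [Module R V] [VertexAlgebra R V]

/-- The coaction `x ↦ φ(d¹x)` on `S ⊗ V` of an endomorphism `φ` of `S ⊗ S ⊗ V`. -/
noncomputable def coaction
    (φ : VertexAlgHom (S ⊗[R] S) ((S ⊗[R] S) ⊗[R] V) ((S ⊗[R] S) ⊗[R] V)) :
    S ⊗[R] V →ₗ[S] S ⊗[R] (S ⊗[R] V) where
  toFun x := TensorProduct.assoc R S S V
    (φ.toLinearMap ((rTensor V (inl R S S)).toLinearMap x))
  map_add' x y := by simp only [map_add]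
  map_smul' s x := by
    rw [tensorMap_smul, map_smul]
    exact assoc_tmul_one_smul s _

theorem coaction_apply (φ : VertexAlgHom (S ⊗[R] S) ((S ⊗[R] S) ⊗[R] V) ((S ⊗[R] S) ⊗[R] V))
    (x : S ⊗[R] V) : coaction φ x = TensorProduct.assoc R S S V
      (φ.toLinearMap ((rTensor V (inl R S S)).toLinearMap x)) := rfl

theorem lTensor_coaction (φ : VertexAlgHom (S ⊗[R] S) ((S ⊗[R] S) ⊗[R] V) ((S ⊗[R] S) ⊗[R] V))
    (z : (S ⊗[R] S) ⊗[R] V) :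
    ((coaction φ).restrictScalars R).lTensor S (TensorProduct.assoc R S S V z) =
      (TensorProduct.assoc R S S V).toLinearMap.lTensor S
        (TensorProduct.assoc R S (S ⊗[R] S) V
          ((baseChange (inr R S (S ⊗[R] S)) φ).toLinearMap
            ((rTensor V (tensorMap (VertexAlgHom.id R S) (inl R S S))).toLinearMap z))) := by
  rw [assoc_baseChange_inr, assoc_rTensor_tensorMap, ← LinearMap.lTensor_comp_apply,
    ← LinearMap.lTensor_comp_apply]
  rfl

theorem lTensor_mk_one_assoc (z : (S ⊗[R] S) ⊗[R] V) :
    (TensorProduct.mk R S (S ⊗[R] V) 1).lTensor S (TensorProduct.assoc R S S V z) =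
      (TensorProduct.assoc R S S V).toLinearMap.lTensor S
        (TensorProduct.assoc R S (S ⊗[R] S) V
          ((rTensor V (tensorMap (VertexAlgHom.id R S) (inr R S S))).toLinearMap z)) := by
  have hmk : TensorProduct.mk R S (S ⊗[R] V) 1 =
      (TensorProduct.assoc R S S V).toLinearMap ∘ₗ (rTensor V (inr R S S)).toLinearMap :=
    LinearMap.ext fun x => (assoc_rTensor_inr x).symm
  rw [assoc_rTensor_tensorMap, ← LinearMap.lTensor_comp_apply, ← hmk]

theorem Cocycle.baseChange_face₂_apply (φ : Cocycle R S (autFunctor R V)) (x : S ⊗[R] V) :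
    (baseChange (face₂ R S 0) (VertexAlgEquiv.toHom φ.val)).toLinearMap
        ((rTensor V (face₂ R S 2)).toLinearMap ((VertexAlgEquiv.toHom φ.val).toLinearMap
          ((rTensor V (inl R S S)).toLinearMap x))) =
      (rTensor V (face₂ R S 1)).toLinearMap ((VertexAlgEquiv.toHom φ.val).toLinearMap
        ((rTensor V (inl R S S)).toLinearMap x)) := by
  have hφ : baseChange (face₂ R S 1) (VertexAlgEquiv.toHom φ.val) =
      (baseChange (face₂ R S 0) (VertexAlgEquiv.toHom φ.val)).comp
        (baseChange (face₂ R S 2) (VertexAlgEquiv.toHom φ.val)) :=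
    congrArg VertexAlgEquiv.toHom φ.property
  have hface : VertexAlgHom.comp (face₂ R S 2) (inl R S S) =
    VertexAlgHom.comp (face₂ R S 1) (inl R S S) := rfl
  rw [← baseChange_tensorMap (face₂ R S 2), ← baseChange_tensorMap (face₂ R S 1), hφ, comp_apply,
    rTensor_rTensor, rTensor_rTensor, hface]

theorem Cocycle.isDescentCoaction (φ : Cocycle R S (autFunctor R V)) :
    IsDescentCoaction (coaction (VertexAlgEquiv.toHom φ.val)) where
  counit x := by
    have hφ : baseChange (mulHom R S) (VertexAlgEquiv.toHom φ.val) =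
      VertexAlgHom.id S (S ⊗[R] V) := congrArg VertexAlgEquiv.toHom φ.map_codegeneracy
    rw [coaction_apply, actionMap_assoc, ← baseChange_tensorMap, hφ, id_apply, rTensor_rTensor,
      mulHom_comp_inl]
    exact LinearMap.congr_fun TensorProduct.map_id x
  coassoc x := by
    rw [coaction_apply, lTensor_coaction, lTensor_mk_one_assoc]
    exact congrArg (fun z => (TensorProduct.assoc R S S V).toLinearMap.lTensor S
      (TensorProduct.assoc R S (S ⊗[R] S) V z)) (φ.baseChange_face₂_apply x)

/-- The `R`-vertex algebra obtained by descent along a cocycle `φ`: the `x` in `S ⊗ V` with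
`φ(d¹x) = d⁰x`. -/
noncomputable def Cocycle.descended (φ : Cocycle R S (autFunctor R V)) :
    VertexSubalgebra R (S ⊗[R] V) :=
  eqLocus (((VertexAlgEquiv.toHom φ.val).restrictScalars R).comp (rTensor V (inl R S S)))
    (rTensor V (inr R S S))

theorem Cocycle.mem_descended {φ : Cocycle R S (autFunctor R V)} {x : S ⊗[R] V} :
    x ∈ φ.descended.toSubmodule ↔ coaction (VertexAlgEquiv.toHom φ.val) x = 1 ⊗ₜ x := by
  rw [coaction_apply, ← assoc_rTensor_inr]
  exact (TensorProduct.assoc R S S V).injective.eq_iff.symm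

theorem Cocycle.exact_descended_subtype (φ : Cocycle R S (autFunctor R V)) :
    Function.Exact φ.descended.subtype.toLinearMap
      ((coaction (VertexAlgEquiv.toHom φ.val)).restrictScalars R -
        TensorProduct.mk R S (S ⊗[R] V) 1) := fun x => by
  refine sub_eq_zero.trans (Cocycle.mem_descended.symm.trans ?_)
  exact Subtype.range_val.symm ▸ Iff.rfl

/-- The trivialization `s ⊗ w ↦ s • w` of the descended algebra. -/
noncomputable def Cocycle.descendedEquiv [Module.Flat R S] (φ : Cocycle R S (autFunctor R V)) :
    VertexAlgEquiv S (S ⊗[R] φ.descended) (S ⊗[R] V) :=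
  VertexAlgEquiv.ofBijective (liftBaseChange S φ.descended.subtype)
    (φ.isDescentCoaction.bijective_liftBaseChange Subtype.val_injective φ.exact_descended_subtype)

theorem Cocycle.descendedEquiv_one_tmul [Module.Flat R S] (φ : Cocycle R S (autFunctor R V))
    (w : φ.descended) : φ.descendedEquiv.toHom.toLinearMap (1 ⊗ₜ w) = w.1 :=
  (LinearMap.liftBaseChange_tmul ..).trans (one_smul S w.1)

theorem Cocycle.baseChange_descendedEquiv_trans [Module.Flat R S]
    (φ : Cocycle R S (autFunctor R V)) :
    (VertexAlgEquiv.baseChange (face₁ R S 1) φ.descendedEquiv).trans φ.val =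
      VertexAlgEquiv.baseChange (face₁ R S 0) φ.descendedEquiv :=
  VertexAlgEquiv.toHom_injective <| ext_tmul fun w => by
    change (VertexAlgEquiv.toHom φ.val).toLinearMap
      ((baseChange (face₁ R S 1) φ.descendedEquiv.toHom).toLinearMap (1 ⊗ₜ w)) =
        (baseChange (face₁ R S 0) φ.descendedEquiv.toHom).toLinearMap (1 ⊗ₜ w)
    rw [baseChange_tmul, baseChange_tmul, one_smul, one_smul, φ.descendedEquiv_one_tmul]
    exact w.2

end Descent

section Comparison

universe r u v

variable {R : Type r} [CommRing R] [CommVertexRing R]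
  {S : Type u} [CommRing S] [CommVertexRing S] [Algebra R S] [VertexAlgebra R S]

section

variable {V W W' : Type v} [AddCommGroup V] [VertexRing V] [Module R V] [VertexAlgebra R V]
  [AddCommGroup W] [VertexRing W] [Module R W] [VertexAlgebra R W]
  [AddCommGroup W'] [VertexRing W'] [Module R W'] [VertexAlgebra R W']

theorem transitionAut_trans (θ : VertexAlgEquiv S (S ⊗[R] W) (S ⊗[R] V))
    (g : VertexAlgEquiv S (S ⊗[R] V) (S ⊗[R] V)) :
    transitionAut (θ.trans g) = VertexAlgEquiv.baseChange (face₁ R S 0) g * transitionAut θ *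
      (VertexAlgEquiv.baseChange (face₁ R S 1) g)⁻¹ := by
  rw [transitionAut, VertexAlgEquiv.baseChange_trans, VertexAlgEquiv.baseChange_trans]
  rfl

theorem transitionAut_extendScalars_trans (f : VertexAlgEquiv R W W')
    (θ : VertexAlgEquiv S (S ⊗[R] W') (S ⊗[R] V)) :
    transitionAut ((f.extendScalars S).trans θ) = transitionAut θ := by
  rw [transitionAut, VertexAlgEquiv.baseChange_trans, VertexAlgEquiv.baseChange_trans,
    VertexAlgEquiv.baseChange_extendScalars, VertexAlgEquiv.baseChange_extendScalars,
    VertexAlgEquiv.trans_symm_trans_trans]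
  rfl

theorem transitionCocycle_refl : transitionCocycle (VertexAlgEquiv.refl S (S ⊗[R] V)) = 1 := by
  have hrefl (f : VertexAlgHom R S (S ⊗[R] S)) :
      VertexAlgEquiv.baseChange f (VertexAlgEquiv.refl S (S ⊗[R] V)) =
        VertexAlgEquiv.refl (S ⊗[R] S) ((S ⊗[R] S) ⊗[R] V) :=
    VertexAlgEquiv.toHom_injective (baseChange_id f)
  refine Subtype.ext ?_
  change transitionAut (VertexAlgEquiv.refl S (S ⊗[R] V)) =
    VertexAlgEquiv.refl (S ⊗[R] S) ((S ⊗[R] S) ⊗[R] V)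
  rw [transitionAut, hrefl, hrefl]
  rfl

theorem mk_transitionCocycle_eq_iff {θ : VertexAlgEquiv S (S ⊗[R] W) (S ⊗[R] V)}
    {θ' : VertexAlgEquiv S (S ⊗[R] W') (S ⊗[R] V)} :
    H1.mk R S (autFunctor R V) (transitionCocycle θ) =
        H1.mk R S (autFunctor R V) (transitionCocycle θ') ↔
      ∃ g : VertexAlgEquiv S (S ⊗[R] V) (S ⊗[R] V),
        transitionAut θ' = transitionAut (θ.trans g) := by
  simp only [transitionAut_trans]
  exact Quotient.eq (r := cocycleSetoid R S (autFunctor R V))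

theorem mk_transitionCocycle_eq_of_equiv (f : VertexAlgEquiv R W W')
    (θ : VertexAlgEquiv S (S ⊗[R] W) (S ⊗[R] V)) (θ' : VertexAlgEquiv S (S ⊗[R] W') (S ⊗[R] V)) :
    H1.mk R S (autFunctor R V) (transitionCocycle θ) =
      H1.mk R S (autFunctor R V) (transitionCocycle θ') :=
  mk_transitionCocycle_eq_iff.mpr ⟨θ.symm.trans ((f.extendScalars S).trans θ'), by
    rw [VertexAlgEquiv.trans_symm_trans, transitionAut_extendScalars_trans]⟩

theorem nonempty_equiv_of_transitionAut_eq [Module.FaithfullyFlat R S]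
    {θ : VertexAlgEquiv S (S ⊗[R] W) (S ⊗[R] V)} {θ' : VertexAlgEquiv S (S ⊗[R] W') (S ⊗[R] V)}
    (h : transitionAut θ = transitionAut θ') : Nonempty (VertexAlgEquiv R W W') := by
  refine nonempty_equiv_of_baseChange_eq (θ.trans θ'.symm) ?_
  rw [VertexAlgEquiv.baseChange_trans, VertexAlgEquiv.baseChange_trans]
  exact VertexAlgEquiv.trans_symm_eq_trans_symm h

end

variable {V : Type v} [AddCommGroup V] [VertexRing V] [Module R V] [VertexAlgebra R V]

/-- The map from classes of forms to `H¹` that sends `W` to the class of `d⁰θ ∘ (d¹θ)⁻¹`, for any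
trivialization `θ : S ⊗ W ≃ S ⊗ V`. -/
noncomputable def FormClasses.cocycleClass : FormClasses R S V → H1 R S (autFunctor R V) :=
  Quotient.lift (fun W => H1.mk R S (autFunctor R V) (transitionCocycle W.isForm.some))
    fun _ _ ⟨f⟩ => mk_transitionCocycle_eq_of_equiv f _ _

theorem FormClasses.cocycleClass_mk (W : TwistedForm R S V)
    (θ : VertexAlgEquiv S (S ⊗[R] W.carrier) (S ⊗[R] V)) :
    (FormClasses.mk R S V W).cocycleClass =
      H1.mk R S (autFunctor R V) (transitionCocycle θ) :=
  mk_transitionCocycle_eq_of_equiv (VertexAlgEquiv.refl R W.carrier) _ θ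

theorem FormClasses.cocycleClass_mk_self :
    (FormClasses.mk R S V (TwistedForm.self R S V)).cocycleClass = 1 :=
  (cocycleClass_mk (TwistedForm.self R S V) (VertexAlgEquiv.refl S (S ⊗[R] V))).trans
    (congrArg (H1.mk R S (autFunctor R V)) transitionCocycle_refl)

theorem FormClasses.cocycleClass_injective [Module.FaithfullyFlat R S] :
    Function.Injective (cocycleClass : FormClasses R S V → _) := by
  rintro ⟨W⟩ ⟨W'⟩ h
  obtain ⟨g, hg⟩ := mk_transitionCocycle_eq_iff.mp h
  exact Quotient.sound (s := twistedFormSetoid R S V)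
    (nonempty_equiv_of_transitionAut_eq hg.symm)

theorem Cocycle.transitionAut_descendedEquiv [Module.Flat R S] {V : Type (max u v)}
    [AddCommGroup V] [VertexRing V] [Module R V] [VertexAlgebra R V]
    (φ : Cocycle R S (autFunctor R V)) : transitionAut φ.descendedEquiv = φ.val := by
  rw [transitionAut, ← φ.baseChange_descendedEquiv_trans]
  exact VertexAlgEquiv.symm_trans_trans _ _

theorem FormClasses.cocycleClass_surjective [Module.Flat R S] {V : Type (max u v)}
    [AddCommGroup V] [VertexRing V] [Module R V] [VertexAlgebra R V] :
    Function.Surjective (cocycleClass : FormClasses R S V → _) := by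
  rintro ⟨(φ : Cocycle R S (autFunctor R V))⟩
  refine ⟨.mk R S V ⟨φ.descended, ⟨φ.descendedEquiv⟩⟩, ?_⟩
  rw [cocycleClass_mk _ φ.descendedEquiv]
  exact congrArg (H1.mk R S (autFunctor R V)) (Subtype.ext φ.transitionAut_descendedEquiv)

end Comparison

end VertexDescent

universe r u v

theorem mainTheorem5 {R : Type r} [CommRing R] [CommVertexRing R]
    {S : Type u} [CommRing S] [CommVertexRing S] [Algebra R S] [VertexAlgebra R S]
    [Module.FaithfullyFlat R S]
    {V : Type (max u v)} [AddCommGroup V] [VertexRing V] [Module R V] [VertexAlgebra R V] :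
    ∃ e : VertexDescent.FormClasses R S V ≃ VertexDescent.H1 R S (VertexDescent.autFunctor R V),
      e (VertexDescent.FormClasses.mk R S V (VertexDescent.TwistedForm.self R S V)) = 1 ∧
      ∀ (W : VertexDescent.TwistedForm R S V)
        (θ : VertexAlgEquiv S (TensorProduct R S W.carrier) (TensorProduct R S V)),
        e (VertexDescent.FormClasses.mk R S V W) =
          VertexDescent.H1.mk R S (VertexDescent.autFunctor R V)
            (VertexDescent.transitionCocycle θ) :=
  ⟨Equiv.ofBijective VertexDescent.FormClasses.cocycleClass
      ⟨VertexDescent.FormClasses.cocycleClass_injective,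
        VertexDescent.FormClasses.cocycleClass_surjective⟩,
    VertexDescent.FormClasses.cocycleClass_mk_self, VertexDescent.FormClasses.cocycleClass_mk⟩
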